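/- (Salmon.) Let $f\in\mathbb C[x_0,x_1,x_2]$ be a homogeneous cubic polynomial whose zero locus $V(f)\subset\mathbb P^2(\mathbb C)$ is smooth, and let $p\in V(f)$. Choose homogeneous coordinates on the projective line $\mathbb P(\mathbb C^3/p)$ of lines through $p$, i.e. a linear map $\ell\colon\mathbb C^3\to\mathbb C^2$ whose kernel is the line $p\subset\mathbb C^3$. Then there is a unique morphism $\pi_p\colon V(f)\to\mathbb P^1$ with $\pi_p([v])=[\ell(v)]$ for every $[v]\in V(f)$, $[v]\neq p$ (the projection from $p$). It is $2:1$ with exactly four ramification points (points of $V(f)$ at which the differential of $\pi_p$ vanishes) and exactly four branch points (images of the ramification points): every branch point has exactly one preimage, and every other point of $\mathbb P^1$ has exactly two. Moreover, the $SL(2)$-class of the unordered quadruple of branch points does not depend on $p$: if $p,q\in V(f)$, and $B_p,B_q\subset\mathbb P^1$ are the sets of branch points of the projections $\pi_p,\pi_q$ from $p$ and $q$, for any choices of the homogeneous coordinates, then there is $g\in SL(2,\mathbb C)$ with $g\cdot B_p=B_q$. -/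

import Mathlib

open MvPolynomial

/-- The complex projective line. -/
abbrev CP1 : Type := Projectivization ℂ (Fin 2 → ℂ)

/-- The complex projective plane. -/
abbrev CP2 : Type := Projectivization ℂ (Fin 3 → ℂ)

/-- The curve `V(f)` in the projective plane, for a homogeneous polynomial `f`
(for which the choice of homogeneous coordinates of a point does not matter). -/
def planeCurve (f : MvPolynomial (Fin 3) ℂ) : Set CP2 :=
  {x | eval x.rep f = 0}

/-- Smoothness of `V(f)`: at every point of the curve some partial derivative is nonzero. -/
def IsSmoothPlaneCurve (f : MvPolynomial (Fin 3) ℂ) : Prop :=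
  ∀ x ∈ planeCurve f, ∃ i, eval x.rep (pderiv i f) ≠ 0

/-- The differential of the polynomial `A` at the vector `u`, applied to the vector `v`. -/
noncomputable def polyDiff (A : MvPolynomial (Fin 3) ℂ) (u v : Fin 3 → ℂ) : ℂ :=
  ∑ i, v i * eval u (pderiv i A)

/-- The pair `(A, B)` of forms of the same degree represents the map `φ : V(f) → ℙ¹` near the
point `x`: the forms do not both vanish at `x`, and `φ(y) = [A(y) : B(y)]` at all points `y` of
the curve at which they do not both vanish. -/
structure RepresentsAt (f : MvPolynomial (Fin 3) ℂ) (φ : planeCurve f → CP1)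
    (x : planeCurve f) (A B : MvPolynomial (Fin 3) ℂ) : Prop where
  same_degree : ∃ d : ℕ, A.IsHomogeneous d ∧ B.IsHomogeneous d
  ne_zero : ![eval x.1.rep A, eval x.1.rep B] ≠ 0
  apply_eq : ∀ (y : planeCurve f) (hy : ![eval y.1.rep A, eval y.1.rep B] ≠ 0),
    φ y = Projectivization.mk ℂ ![eval y.1.rep A, eval y.1.rep B] hy

/-- `φ : V(f) → ℙ¹` is a morphism of projective varieties: near every point it is given by a
pair of forms of the same degree without common zero. -/
def IsMorphism (f : MvPolynomial (Fin 3) ℂ) (φ : planeCurve f → CP1) : Prop :=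
  ∀ x, ∃ A B, RepresentsAt f φ x A B

/-- `φ` is ramified at `x`: its differential vanishes on the tangent line of the curve at `x`.
If `φ = [A : B]` near `x`, then the differential of `φ` sends a tangent vector of the curve,
given by some `v` with `df_x(v) = 0`, to `A(x) dB_x(v) - B(x) dA_x(v)`, up to a nonzero factor. -/
def IsRamifiedAt (f : MvPolynomial (Fin 3) ℂ) (φ : planeCurve f → CP1)
    (x : planeCurve f) : Prop :=
  ∃ A B, RepresentsAt f φ x A B ∧
    ∀ v : Fin 3 → ℂ, polyDiff f x.1.rep v = 0 →
      eval x.1.rep A * polyDiff B x.1.rep v - eval x.1.rep B * polyDiff A x.1.rep v = 0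

/-- The set of ramification points of `φ`, on the curve. -/
def ramificationPoints (f : MvPolynomial (Fin 3) ℂ) (φ : planeCurve f → CP1) :
    Set (planeCurve f) :=
  {x | IsRamifiedAt f φ x}

/-- The set of branch points of `φ`, on the line: the images of the ramification points. -/
def branchPoints (f : MvPolynomial (Fin 3) ℂ) (φ : planeCurve f → CP1) : Set CP1 :=
  φ '' ramificationPoints f φ

/-- `φ : V(f) → ℙ¹` is the projection of the curve from its point `p`: it is a morphism, and away
from `p` it is induced by the linear map `ℓ : ℂ³ → ℂ²`, whose kernel is the line `p`. The choice
of `ℓ` is the choice of homogeneous coordinates on the projective line `ℙ(ℂ³/p)` of all lines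
through `p`. -/
structure IsProjectionFrom (f : MvPolynomial (Fin 3) ℂ) (p : planeCurve f)
    (ℓ : (Fin 3 → ℂ) →ₗ[ℂ] (Fin 2 → ℂ)) (φ : planeCurve f → CP1) : Prop where
  ker_eq : LinearMap.ker ℓ = p.1.submodule
  isMorphism : IsMorphism f φ
  apply_eq : ∀ (x : planeCurve f) (hx : ℓ x.1.rep ≠ 0),
    φ x = Projectivization.mk ℂ (ℓ x.1.rep) hx

/-! Take coordinates with p = (0 : 0 : 1) and ℓ = (x, y). Then f = z² L + z Q + C with L, Q, C
binary forms in (x, y) of degrees 1, 2, 3. On the line through p in the direction (x : y) the form f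
splits off the factor vanishing at p, and the residual quadratic has discriminant D = Q² − 4LC, a
binary quartic (`PointedCubic.disc`). A multiple zero of D would produce a singular point of the
curve or a line inside it, so smoothness gives D four simple zeros (`Smooth.disc_nonsingular`).
Fibres have one point over the zeros of D and two elsewhere (`ncard_fibre`), and ramification occurs
exactly over the zeros (`isRamifiedAt_iff`). At p itself the value of a morphism is forced to be the
tangent direction (`apply_center`), and writing f = xB − yA shows that [A : B] extends [x : y]
across p (`representsAt_center`).

For the independence of p: the zero set of a quartic with simple zeros is determined up to SL(2) by
the invariants I and J (`zerosEquiv_normalForm`). Coordinate changes keeping p as the last basis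
vector alter D only by a linear substitution in (x, y) (`zerosEquiv_disc`). For distinct p and q one
may therefore put p at (0 : 0 : 1) and q at (1 : 0 : 0) in the same coordinates. Exchanging x and z
then passes from p to q, and the two discriminants have equal I and equal J
(`zerosEquiv_disc_of_points`). -/

/-! ### Differentials of polynomials and tangent vectors -/

/-- The differential of a polynomial as a continuous linear map. -/
noncomputable def polyDiffCLM (A : MvPolynomial (Fin 3) ℂ) (u : Fin 3 → ℂ) :
    (Fin 3 → ℂ) →L[ℂ] ℂ :=
  ∑ i, eval u (pderiv i A) • ContinuousLinearMap.proj i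

theorem polyDiffCLM_apply (A : MvPolynomial (Fin 3) ℂ) (u v : Fin 3 → ℂ) :
    polyDiffCLM A u v = polyDiff A u v := by
  simp [polyDiffCLM, polyDiff, mul_comm]

theorem hasStrictFDerivAt_eval (A : MvPolynomial (Fin 3) ℂ) (u : Fin 3 → ℂ) :
    HasStrictFDerivAt (fun v => eval v A) (polyDiffCLM A u) u := by
  induction A using MvPolynomial.induction_on with
  | C a =>
    refine (funext fun v => (eval_C a).symm : (fun _ => a) = fun v => eval v (C a)) ▸
      (hasStrictFDerivAt_const (𝕜 := ℂ) a u).congr_fderiv ?_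
    ext; simp [polyDiffCLM_apply, polyDiff]
  | add p q hp hq =>
    have := (hp.add hq).congr_fderiv (g' := polyDiffCLM (p + q) u) (by
      ext; simp [polyDiffCLM_apply, polyDiff, mul_add, Finset.sum_add_distrib])
    refine this.congr_of_eventuallyEq (Filter.Eventually.of_forall fun v => ?_)
    simp
  | mul_X p j hp =>
    have := (hp.mul (ContinuousLinearMap.proj (R := ℂ) (φ := fun _ : Fin 3 => ℂ)
      j).hasStrictFDerivAt).congr_fderiv (g' := polyDiffCLM (p * X j) u) (by
        ext v
        fin_cases j <;> simp [polyDiffCLM_apply, polyDiff, Fin.sum_univ_three, pderiv_X] <;> ring)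
    refine this.congr_of_eventuallyEq (Filter.Eventually.of_forall fun v => ?_)
    simp

theorem polyDiff_smul_right (A : MvPolynomial (Fin 3) ℂ) (u v : Fin 3 → ℂ) (c : ℂ) :
    polyDiff A u (c • v) = c * polyDiff A u v := by
  simp [← polyDiffCLM_apply]

theorem polyDiff_add (A B : MvPolynomial (Fin 3) ℂ) (u v : Fin 3 → ℂ) :
    polyDiff (A + B) u v = polyDiff A u v + polyDiff B u v := by
  simp only [polyDiff, Fin.sum_univ_three, map_add]; ring

theorem polyDiff_neg (A : MvPolynomial (Fin 3) ℂ) (u v : Fin 3 → ℂ) :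
    polyDiff (-A) u v = -polyDiff A u v := by
  simp only [polyDiff, Fin.sum_univ_three, map_neg]; ring

theorem polyDiff_sub (A B : MvPolynomial (Fin 3) ℂ) (u v : Fin 3 → ℂ) :
    polyDiff (A - B) u v = polyDiff A u v - polyDiff B u v := by
  simp only [polyDiff, Fin.sum_univ_three, map_sub]; ring

theorem polyDiff_mul (A B : MvPolynomial (Fin 3) ℂ) (u v : Fin 3 → ℂ) :
    polyDiff (A * B) u v = eval u A * polyDiff B u v + eval u B * polyDiff A u v := by
  simp only [polyDiff, Fin.sum_univ_three, Derivation.leibniz, smul_eq_mul, map_add, map_mul]; ring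

theorem polyDiff_C (a : ℂ) (u v : Fin 3 → ℂ) : polyDiff (C a) u v = 0 := by
  simp [polyDiff]

/-- The derivative of a polynomial along a line. -/
theorem polyDiff_eq_of_hasDerivAt {A : MvPolynomial (Fin 3) ℂ} {u v : Fin 3 → ℂ} {c : ℂ}
    (h : HasDerivAt (fun t : ℂ => eval (u + t • v) A) c 0) : polyDiff A u v = c := by
  have h1 : HasDerivAt (fun t : ℂ => u + t • v) v 0 := by
    simpa using ((hasDerivAt_id (0 : ℂ)).smul_const v).const_add u
  have h2 : HasFDerivAt (fun v => eval v A) (polyDiffCLM A u) (u + (0 : ℂ) • v) := by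
    simpa using (hasStrictFDerivAt_eval A u).hasFDerivAt
  have := h2.comp_hasDerivAt (0 : ℂ) h1
  rw [← polyDiffCLM_apply]
  exact this.unique h

/-- A polynomial that vanishes wherever `f` does has differential zero on the tangent spaces of
the zero locus of `f` at its smooth points. -/
theorem polyDiff_eq_zero_of_vanishing {f G : MvPolynomial (Fin 3) ℂ} {u v w : Fin 3 → ℂ}
    (hG : ∀ x ≠ 0, eval x f = 0 → eval x G = 0) (hu₀ : u ≠ 0) (hu : eval u f = 0)
    (hw : polyDiff f u w ≠ 0)
    (hv : polyDiff f u v = 0) : polyDiff G u v = 0 := by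
  -- Lagrange multipliers over ℝ: Re G is constantly zero on the level set of f near u, so u is a
  -- constrained extremum. The point 0 is cut out of the neighbourhood because `hG` says nothing
  -- there.
  have hf' := (hasStrictFDerivAt_eval f u).restrictScalars ℝ
  have hG' := (hasStrictFDerivAt_eval G u).restrictScalars ℝ
  have hre := (Complex.reCLM.hasStrictFDerivAt (x := eval u G)).comp u hG'
  have hext : IsLocalExtrOn (Complex.reCLM ∘ fun x => eval x G)
      {x | eval x f = eval u f} u := by
    left
    filter_upwards [self_mem_nhdsWithin, nhdsWithin_le_nhds (isOpen_ne.mem_nhds hu₀)] with x hx hx₀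
    have hx' : eval x f = 0 := by rw [← hu]; exact hx
    simp [hG x hx₀ hx', hG u hu₀ hu]
  obtain ⟨Λ, Λ₀, hΛ, h⟩ := hext.exists_linear_map_of_hasStrictFDerivAt hf' hre
  have h' : ∀ x, Λ (polyDiff f u x) + Λ₀ * (polyDiff G u x).re = 0 := fun x => by
    simpa [polyDiffCLM_apply] using h x
  -- By `hw` the differential of f is onto ℂ, so Λ₀ = 0 would force Λ = 0 as well.
  have hΛ₀ : Λ₀ ≠ 0 := by
    rintro rfl
    apply hΛ
    have : Λ = 0 := by
      ext c
      all_goals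
        first
        | simpa [polyDiff_smul_right, hw] using h' ((1 / polyDiff f u w) • w)
        | simpa [polyDiff_smul_right, hw] using h' ((c / polyDiff f u w) • w)
    simp [this]
  have key : ∀ x, polyDiff f u x = 0 → (polyDiff G u x).re = 0 := fun x hx => by
    simpa [hx, hΛ₀] using h' x
  apply Complex.ext
  · simpa using key v hv
  -- The tangent space is complex: the real part at iv controls the imaginary part at v.
  · simpa [polyDiff_smul_right] using key (Complex.I • v) (by simp [polyDiff_smul_right, hv])

/-! ### Points of the projective line and representations of a map -/

theorem cross_eq_zero_iff_mk_eq_mk {v w : Fin 2 → ℂ} (hv : v ≠ 0) (hw : w ≠ 0) :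
    (Projectivization.mk ℂ v hv : CP1) = Projectivization.mk ℂ w hw ↔
      v 0 * w 1 - v 1 * w 0 = 0 := by
  rw [Projectivization.mk_eq_mk_iff']
  constructor
  · rintro ⟨k, rfl⟩
    simp only [Pi.smul_apply, smul_eq_mul]; ring
  · intro h
    by_cases h0 : w 0 = 0
    · have h1 : w 1 ≠ 0 := fun h1 => hw (by ext i; fin_cases i <;> simp [h0, h1])
      have hv0 : v 0 = 0 := by simpa [h0, h1] using h
      exact ⟨v 1 / w 1, by ext i; fin_cases i <;> simp [h0, h1, hv0]⟩
    · refine ⟨v 0 / w 0, ?_⟩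
      ext i; fin_cases i
      · simp [h0]
      · simp only [Fin.mk_one, Pi.smul_apply, smul_eq_mul]
        field_simp
        linear_combination h

theorem ne_zero_of_fin_two {v : Fin 2 → ℂ} : v ≠ 0 ↔ v 0 ≠ 0 ∨ v 1 ≠ 0 := by
  rw [← not_and_or, not_iff_not]
  exact ⟨fun h => by simp [h], fun h => by ext i; fin_cases i <;> simp [h]⟩

theorem eval_smul_of_isHomogeneous {G : MvPolynomial (Fin 3) ℂ} {n : ℕ} (hG : G.IsHomogeneous n)
    (c : ℂ) (v : Fin 3 → ℂ) : eval (c • v) G = c ^ n * eval v G := by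
  rw [eval_eq', eval_eq', Finset.mul_sum]
  refine Finset.sum_congr rfl fun d hd => ?_
  have : d 0 + d 1 + d 2 = n := by
    have := hG (mem_support_iff.mp hd)
    simpa [Finsupp.weight_apply, Finsupp.sum_fintype, Fin.sum_univ_three] using this
  simp only [Fin.prod_univ_three, Pi.smul_apply, smul_eq_mul, mul_pow, ← this, pow_add]
  ring

theorem mk_mem_planeCurve {f : MvPolynomial (Fin 3) ℂ} {n : ℕ} (hf : f.IsHomogeneous n)
    {u : Fin 3 → ℂ} (hu : u ≠ 0) :
    Projectivization.mk ℂ u hu ∈ planeCurve f ↔ eval u f = 0 := by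
  obtain ⟨a, ha⟩ := Projectivization.exists_smul_eq_mk_rep ℂ u hu
  rw [planeCurve, Set.mem_ofPred_eq, ← ha, Units.smul_def, eval_smul_of_isHomogeneous hf]
  simp

/-- A form vanishing on the points of the curve vanishes on its cone. -/
theorem eval_eq_zero_of_forall_planeCurve {f G : MvPolynomial (Fin 3) ℂ} {m n : ℕ}
    (hf : f.IsHomogeneous m) (hG : G.IsHomogeneous n)
    (h : ∀ y : planeCurve f, eval y.1.rep G = 0) (v : Fin 3 → ℂ) (hv : v ≠ 0)
    (hfv : eval v f = 0) : eval v G = 0 := by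
  have := h ⟨_, (mk_mem_planeCurve hf hv).2 hfv⟩
  obtain ⟨a, ha⟩ := Projectivization.exists_smul_eq_mk_rep ℂ v hv
  rw [← ha, Units.smul_def, eval_smul_of_isHomogeneous hG] at this
  simpa using this

/-- Two representations of a map agree on the curve. -/
theorem RepresentsAt.cross_eq_zero {f : MvPolynomial (Fin 3) ℂ} {φ : planeCurve f → CP1}
    {x x' : planeCurve f} {A B A' B' : MvPolynomial (Fin 3) ℂ} (h : RepresentsAt f φ x A B)
    (h' : RepresentsAt f φ x' A' B') (y : planeCurve f) :
    eval y.1.rep (A * B' - B * A') = 0 := by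
  by_cases hy : ![eval y.1.rep A, eval y.1.rep B] = 0
  · have h0 := congr_fun hy 0
    have h1 := congr_fun hy 1
    simp at h0 h1
    simp [h0, h1]
  by_cases hy' : ![eval y.1.rep A', eval y.1.rep B'] = 0
  · have h0 := congr_fun hy' 0
    have h1 := congr_fun hy' 1
    simp at h0 h1
    simp [h0, h1]
  · have := (h.apply_eq y hy).symm.trans (h'.apply_eq y hy')
    rw [cross_eq_zero_iff_mk_eq_mk] at this
    simpa using this

/-- The vanishing of the differential does not depend on the representation of the map. -/
theorem RepresentsAt.differential_eq_zero {f : MvPolynomial (Fin 3) ℂ} {φ : planeCurve f → CP1}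
    {x : planeCurve f} {A B A' B' : MvPolynomial (Fin 3) ℂ} {n : ℕ} (hf : f.IsHomogeneous n)
    (h : RepresentsAt f φ x A B) (h' : RepresentsAt f φ x A' B') {w v : Fin 3 → ℂ}
    (hw : polyDiff f x.1.rep w ≠ 0) (hv : polyDiff f x.1.rep v = 0)
    (hA : eval x.1.rep A * polyDiff B x.1.rep v - eval x.1.rep B * polyDiff A x.1.rep v = 0) :
    eval x.1.rep A' * polyDiff B' x.1.rep v - eval x.1.rep B' * polyDiff A' x.1.rep v = 0 := by
  obtain ⟨d, hd, hd'⟩ := h.same_degree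
  obtain ⟨e, he, he'⟩ := h'.same_degree
  have h0 := h.cross_eq_zero h' x
  -- AB' − BA' vanishes on the curve, hence so does its differential along v.
  have hG := polyDiff_eq_zero_of_vanishing (eval_eq_zero_of_forall_planeCurve hf
    ((hd.mul he').sub (hd'.mul he)) (h.cross_eq_zero h')) x.1.rep_nonzero x.2 hw hv
  simp only [polyDiff_sub, polyDiff_mul] at hG
  simp only [map_sub, map_mul] at h0
  have hne := h.ne_zero
  rw [ne_zero_of_fin_two] at hne
  simp only [Matrix.cons_val_zero, Matrix.cons_val_one] at hne
  generalize eval x.1.rep A = a at *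
  generalize eval x.1.rep B = b at *
  generalize eval x.1.rep A' = a' at *
  generalize eval x.1.rep B' = b' at *
  rcases hne with hne | hne <;> apply mul_left_cancel₀ (pow_ne_zero 2 hne)
  · linear_combination a * a' * hG + a' ^ 2 * hA -
      (a * polyDiff A' x.1.rep v + a' * polyDiff A x.1.rep v) * h0
  · linear_combination b * b' * hG + b' ^ 2 * hA -
      (b * polyDiff B' x.1.rep v + b' * polyDiff B x.1.rep v) * h0

/-! ### Cubics with a marked point -/

/-- The coefficients of a plane cubic through the point `(0 : 0 : 1)`. -/
structure PointedCubic where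
  (l0 l1 q0 q1 q2 c0 c1 c2 c3 : ℂ)

namespace PointedCubic

variable (F : PointedCubic)

/-- The coefficient of `z ^ 2`: the equation of the tangent line at `(0 : 0 : 1)`. -/
def lin (x y : ℂ) : ℂ := F.l0 * x + F.l1 * y

/-- The coefficient of `z`. -/
def quad (x y : ℂ) : ℂ := F.q0 * x ^ 2 + F.q1 * x * y + F.q2 * y ^ 2

/-- The constant coefficient with respect to `z`. -/
def cub (x y : ℂ) : ℂ := F.c0 * x ^ 3 + F.c1 * x ^ 2 * y + F.c2 * x * y ^ 2 + F.c3 * y ^ 3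

/-- The value of the cubic form. -/
def eval (x y z : ℂ) : ℂ := z ^ 2 * F.lin x y + z * F.quad x y + F.cub x y

/-- The partial derivative in `x`. -/
def dx (x y z : ℂ) : ℂ :=
  z ^ 2 * F.l0 + z * (2 * F.q0 * x + F.q1 * y) + (3 * F.c0 * x ^ 2 + 2 * F.c1 * x * y + F.c2 * y ^ 2)

/-- The partial derivative in `y`. -/
def dy (x y z : ℂ) : ℂ :=
  z ^ 2 * F.l1 + z * (F.q1 * x + 2 * F.q2 * y) + (F.c1 * x ^ 2 + 2 * F.c2 * x * y + 3 * F.c3 * y ^ 2)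

/-- The partial derivative in `z`. -/
def dz (x y z : ℂ) : ℂ := 2 * z * F.lin x y + F.quad x y

/-- The cubic has no singular point. -/
def Smooth : Prop :=
  ∀ x y z, F.eval x y z = 0 → F.dx x y z = 0 → F.dy x y z = 0 → F.dz x y z = 0 →
    x = 0 ∧ y = 0 ∧ z = 0

/-- Taylor expansion along a line; its linear term identifies `polyDiff` in an arbitrary basis. -/
theorem eval_add_mul (x y z x' y' z' t : ℂ) :
    F.eval (x + t * x') (y + t * y') (z + t * z') = F.eval x y z +
      t * (x' * F.dx x y z + y' * F.dy x y z + z' * F.dz x y z) +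
      t ^ 2 * (x * F.dx x' y' z' + y * F.dy x' y' z' + z * F.dz x' y' z') +
      t ^ 3 * F.eval x' y' z' := by
  simp only [eval, dx, dy, dz, lin, quad, cub]; ring

theorem euler (x y z : ℂ) :
    x * F.dx x y z + y * F.dy x y z + z * F.dz x y z = 3 * F.eval x y z := by
  simp only [eval, dx, dy, dz, lin, quad, cub]; ring

end PointedCubic

/-- `F` is the expression of the form `f` in the coordinates given by the basis `b`. -/
def IsExpansion (f : MvPolynomial (Fin 3) ℂ) (b : Module.Basis (Fin 3) ℂ (Fin 3 → ℂ))
    (F : PointedCubic) : Prop :=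
  ∀ v, eval v f = F.eval (b.repr v 0) (b.repr v 1) (b.repr v 2)

/-- The values of a ternary cubic form, by its ten coefficients. -/
theorem exists_eval_eq_of_isHomogeneous_three {f : MvPolynomial (Fin 3) ℂ}
    (hf : f.IsHomogeneous 3) :
    ∃ (F : PointedCubic) (a : ℂ), ∀ v, eval v f = F.eval (v 0) (v 1) (v 2) + a * v 2 ^ 3 := by
  rw [f.as_sum]
  have H : ∀ d ∈ f.support, d 0 + d 1 + d 2 = 3 := fun d hd => by
    have := hf (mem_support_iff.mp hd)
    simpa [Finsupp.weight_apply, Finsupp.sum_fintype, Fin.sum_univ_three] using this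
  revert H
  -- Induction over an arbitrary finite set of exponents of degree 3; each of the ten monomials
  -- feeds one coefficient slot.
  generalize f.support = S
  intro H
  induction S using Finset.induction_on with
  | empty => exact ⟨⟨0, 0, 0, 0, 0, 0, 0, 0, 0⟩, 0, fun v => by
      simp [PointedCubic.eval, PointedCubic.lin, PointedCubic.quad, PointedCubic.cub]⟩
  | insert d S hd ih =>
    obtain ⟨F, a, hF⟩ := ih fun e he => H e (Finset.mem_insert_of_mem he)
    have h3 := H d (Finset.mem_insert_self d S)
    have hm : ∀ v : Fin 3 → ℂ, eval v (∑ x ∈ insert d S, monomial x (coeff x f)) =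
        coeff d f * (v 0 ^ d 0 * v 1 ^ d 1 * v 2 ^ d 2) +
          (F.eval (v 0) (v 1) (v 2) + a * v 2 ^ 3) := fun v => by
      rw [Finset.sum_insert hd, map_add, hF, eval_monomial, Finsupp.prod_fintype _ _ (by simp),
        Fin.prod_univ_three]
    simp only [hm]
    generalize coeff d f = k
    obtain ⟨l0, l1, q0, q1, q2, c0, c1, c2, c3⟩ := F
    have h0 : d 0 ≤ 3 := by omega
    have h1 : d 1 ≤ 3 := by omega
    have h2 : d 2 = 3 - d 0 - d 1 := by omega
    rw [h2]
    generalize d 0 = i at *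
    generalize d 1 = j at *
    have hij : i + j ≤ 3 := by omega
    clear h3 h2 hm hF
    interval_cases i <;> interval_cases j <;> first | omega | skip
    · exact ⟨⟨l0, l1, q0, q1, q2, c0, c1, c2, c3⟩, a + k, fun v => by
        simp [PointedCubic.eval, PointedCubic.lin, PointedCubic.quad, PointedCubic.cub]; ring⟩
    · exact ⟨⟨l0, l1 + k, q0, q1, q2, c0, c1, c2, c3⟩, a, fun v => by
        simp [PointedCubic.eval, PointedCubic.lin, PointedCubic.quad, PointedCubic.cub]; ring⟩
    · exact ⟨⟨l0, l1, q0, q1, q2 + k, c0, c1, c2, c3⟩, a, fun v => by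
        simp [PointedCubic.eval, PointedCubic.lin, PointedCubic.quad, PointedCubic.cub]; ring⟩
    · exact ⟨⟨l0, l1, q0, q1, q2, c0, c1, c2, c3 + k⟩, a, fun v => by
        simp [PointedCubic.eval, PointedCubic.lin, PointedCubic.quad, PointedCubic.cub]; ring⟩
    · exact ⟨⟨l0 + k, l1, q0, q1, q2, c0, c1, c2, c3⟩, a, fun v => by
        simp [PointedCubic.eval, PointedCubic.lin, PointedCubic.quad, PointedCubic.cub]; ring⟩
    · exact ⟨⟨l0, l1, q0, q1 + k, q2, c0, c1, c2, c3⟩, a, fun v => by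
        simp [PointedCubic.eval, PointedCubic.lin, PointedCubic.quad, PointedCubic.cub]; ring⟩
    · exact ⟨⟨l0, l1, q0, q1, q2, c0, c1, c2 + k, c3⟩, a, fun v => by
        simp [PointedCubic.eval, PointedCubic.lin, PointedCubic.quad, PointedCubic.cub]; ring⟩
    · exact ⟨⟨l0, l1, q0 + k, q1, q2, c0, c1, c2, c3⟩, a, fun v => by
        simp [PointedCubic.eval, PointedCubic.lin, PointedCubic.quad, PointedCubic.cub]; ring⟩
    · exact ⟨⟨l0, l1, q0, q1, q2, c0, c1 + k, c2, c3⟩, a, fun v => by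
        simp [PointedCubic.eval, PointedCubic.lin, PointedCubic.quad, PointedCubic.cub]; ring⟩
    · exact ⟨⟨l0, l1, q0, q1, q2, c0 + k, c1, c2, c3⟩, a, fun v => by
        simp [PointedCubic.eval, PointedCubic.lin, PointedCubic.quad, PointedCubic.cub]; ring⟩

/-- Substituting the basis into f gives a cubic in the coordinates; its z³ coefficient is the value
of f at `b 2`, which is zero. -/
theorem exists_isExpansion {f : MvPolynomial (Fin 3) ℂ} (hf : f.IsHomogeneous 3)
    (b : Module.Basis (Fin 3) ℂ (Fin 3 → ℂ)) (hb : eval (b 2) f = 0) :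
    ∃ F, IsExpansion f b F := by
  let g : Fin 3 → MvPolynomial (Fin 3) ℂ := fun i => ∑ j, C (b j i) * X j
  have hg : ∀ i, (g i).IsHomogeneous 1 := fun i =>
    IsHomogeneous.sum _ _ _ fun j _ => by
      simpa using (isHomogeneous_C (Fin 3) (b j i)).mul (isHomogeneous_X ℂ j)
  obtain ⟨F, a, hF⟩ := exists_eval_eq_of_isHomogeneous_three (by simpa using hf.aeval g hg)
  have key : ∀ v, eval v f =
      F.eval (b.repr v 0) (b.repr v 1) (b.repr v 2) + a * b.repr v 2 ^ 3 := fun v => by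
    rw [← hF, ← coe_aeval_eq_eval, ← coe_aeval_eq_eval, RingHom.coe_coe, RingHom.coe_coe,
      aeval_bind₁]
    congr 2
    funext i
    conv_lhs => rw [← b.sum_repr v]
    simp [g, mul_comm]
  have ha : a = 0 := by
    have := key (b 2)
    simpa [hb, PointedCubic.eval, PointedCubic.lin, PointedCubic.quad, PointedCubic.cub] using
      this.symm
  exact ⟨F, fun v => by simp [key, ha]⟩

namespace IsExpansion

variable {f : MvPolynomial (Fin 3) ℂ} {b : Module.Basis (Fin 3) ℂ (Fin 3 → ℂ)} {F : PointedCubic}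

theorem polyDiff_eq (h : IsExpansion f b F) (u v : Fin 3 → ℂ) :
    polyDiff f u v =
      b.repr v 0 * F.dx (b.repr u 0) (b.repr u 1) (b.repr u 2) +
      b.repr v 1 * F.dy (b.repr u 0) (b.repr u 1) (b.repr u 2) +
      b.repr v 2 * F.dz (b.repr u 0) (b.repr u 1) (b.repr u 2) := by
  apply polyDiff_eq_of_hasDerivAt
  simp only [h _, map_add, map_smul, Finsupp.add_apply, Finsupp.smul_apply, smul_eq_mul,
    F.eval_add_mul]
  generalize F.eval (b.repr u 0) (b.repr u 1) (b.repr u 2) = k0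
  generalize _ + b.repr v 2 * F.dz (b.repr u 0) (b.repr u 1) (b.repr u 2) = k1
  generalize _ + b.repr u 2 * F.dz (b.repr v 0) (b.repr v 1) (b.repr v 2) = k2
  generalize F.eval (b.repr v 0) (b.repr v 1) (b.repr v 2) = k3
  have h1 := (hasDerivAt_id (0 : ℂ)).mul_const k1
  have h2 := ((hasDerivAt_id (0 : ℂ)).pow 2).mul_const k2
  have h3 := ((hasDerivAt_id (0 : ℂ)).pow 3).mul_const k3
  exact (((h1.const_add k0).add h2).add h3).congr_deriv (by simp)

/-- Smoothness is only tested at the chosen representatives; this scaling carries it to every vector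
of the cone. -/
theorem smul_left (h : IsExpansion f b F) (u v : Fin 3 → ℂ) (c : ℂ) :
    polyDiff f (c • u) v = c ^ 2 * polyDiff f u v := by
  simp only [h.polyDiff_eq, map_smul, Finsupp.smul_apply, smul_eq_mul, PointedCubic.dx,
    PointedCubic.dy, PointedCubic.dz, PointedCubic.lin, PointedCubic.quad]
  ring

theorem smooth (h : IsExpansion f b F) (hf : f.IsHomogeneous 3)
    (hs : IsSmoothPlaneCurve f) : F.Smooth := by
  intro x y z h0 hx hy hz
  by_contra hne
  let u : Fin 3 → ℂ := x • b 0 + y • b 1 + z • b 2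
  have hu0 : b.repr u 0 = x := by simp [u]
  have hu1 : b.repr u 1 = y := by simp [u]
  have hu2 : b.repr u 2 = z := by simp [u]
  have hu : u ≠ 0 := by
    intro hu
    rw [hu] at hu0 hu1 hu2
    simp only [map_zero, Finsupp.zero_apply] at hu0 hu1 hu2
    exact hne ⟨hu0.symm, hu1.symm, hu2.symm⟩
  obtain ⟨a, ha⟩ := Projectivization.exists_smul_eq_mk_rep ℂ u hu
  obtain ⟨i, hi⟩ := hs _ ((mk_mem_planeCurve hf hu).2 (by rw [h u, hu0, hu1, hu2, h0]))
  apply hi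
  have : polyDiff f (a • u) (Pi.single i 1) = eval (a • u) (pderiv i f) := by
    simp [polyDiff, Pi.single_apply]
  rw [← ha, ← this, Units.smul_def, h.smul_left, h.polyDiff_eq, hu0, hu1, hu2, hx, hy, hz]
  simp

end IsExpansion

/-! ### Binary quartics, their invariants and their zeros up to SL(2) -/

/-- The coefficients of a binary quartic form. -/
structure BinaryQuartic where
  (a b c d e : ℂ)

namespace BinaryQuartic

variable (D : BinaryQuartic)

/-- The value of the quartic form. -/
def eval (x y : ℂ) : ℂ :=
  D.a * x ^ 4 + D.b * x ^ 3 * y + D.c * x ^ 2 * y ^ 2 + D.d * x * y ^ 3 + D.e * y ^ 4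

/-- The partial derivative in `x`. -/
def dx (x y : ℂ) : ℂ :=
  4 * D.a * x ^ 3 + 3 * D.b * x ^ 2 * y + 2 * D.c * x * y ^ 2 + D.d * y ^ 3

/-- The partial derivative in `y`. -/
def dy (x y : ℂ) : ℂ :=
  D.b * x ^ 3 + 2 * D.c * x ^ 2 * y + 3 * D.d * x * y ^ 2 + 4 * D.e * y ^ 3

/-- The quadratic invariant, up to a factor. -/
def invI : ℂ := 12 * D.a * D.e - 3 * D.b * D.d + D.c ^ 2

/-- The cubic invariant, up to a factor. -/
def invJ : ℂ :=
  72 * D.a * D.c * D.e + 9 * D.b * D.c * D.d - 27 * D.a * D.d ^ 2 - 27 * D.e * D.b ^ 2 - 2 * D.c ^ 3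

/-- All zeros of the form on the projective line are simple. -/
def Nonsingular : Prop :=
  ∀ x y, D.eval x y = 0 → D.dx x y = 0 → D.dy x y = 0 → x = 0 ∧ y = 0

/-- The substitution of `(p x + q y, r x + s y)` for `(x, y)`. -/
def comp (p q r s : ℂ) : BinaryQuartic where
  a := D.eval p r
  b := q * D.dx p r + s * D.dy p r
  c := 6 * D.a * p ^ 2 * q ^ 2 + D.b * (3 * p ^ 2 * q * s + 3 * p * q ^ 2 * r) +
    D.c * (p ^ 2 * s ^ 2 + 4 * p * q * r * s + q ^ 2 * r ^ 2) +
    D.d * (3 * p * r * s ^ 2 + 3 * q * r ^ 2 * s) + 6 * D.e * r ^ 2 * s ^ 2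
  d := p * D.dx q s + r * D.dy q s
  e := D.eval q s

theorem comp_eval (p q r s x y : ℂ) :
    (D.comp p q r s).eval x y = D.eval (p * x + q * y) (r * x + s * y) := by
  simp only [comp, eval, dx, dy]; ring

theorem comp_dx (p q r s x y : ℂ) :
    (D.comp p q r s).dx x y =
      p * D.dx (p * x + q * y) (r * x + s * y) + r * D.dy (p * x + q * y) (r * x + s * y) := by
  simp only [comp, eval, dx, dy]; ring

theorem comp_dy (p q r s x y : ℂ) :
    (D.comp p q r s).dy x y =
      q * D.dx (p * x + q * y) (r * x + s * y) + s * D.dy (p * x + q * y) (r * x + s * y) := by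
  simp only [comp, eval, dx, dy]; ring

theorem comp_invI (p q r s : ℂ) :
    (D.comp p q r s).invI = (p * s - q * r) ^ 4 * D.invI := by
  simp only [comp, eval, dx, dy, invI]; ring

theorem comp_invJ (p q r s : ℂ) :
    (D.comp p q r s).invJ = (p * s - q * r) ^ 6 * D.invJ := by
  simp only [comp, eval, dx, dy, invJ]; ring

theorem eval_smul (k x y : ℂ) : D.eval (k * x) (k * y) = k ^ 4 * D.eval x y := by
  simp only [eval]; ring

theorem euler (x y : ℂ) : x * D.dx x y + y * D.dy x y = 4 * D.eval x y := by
  simp only [eval, dx, dy]; ring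

theorem Nonsingular.comp {D : BinaryQuartic} (hD : D.Nonsingular) {p q r s : ℂ}
    (h : p * s - q * r = 1) : (D.comp p q r s).Nonsingular := by
  intro x y h0 hx hy
  rw [comp_eval] at h0
  rw [comp_dx] at hx
  rw [comp_dy] at hy
  obtain ⟨h1, h2⟩ := hD (p * x + q * y) (r * x + s * y) h0
    (by linear_combination s * hx - r * hy - D.dx (p * x + q * y) (r * x + s * y) * h)
    (by linear_combination -q * hx + p * hy - D.dy (p * x + q * y) (r * x + s * y) * h)
  exact ⟨by linear_combination s * h1 - q * h2 - x * h,
    by linear_combination p * h2 - r * h1 - y * h⟩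

/-- The zeros of the form on the projective line. -/
def zeros : Set CP1 := {w | D.eval (w.rep 0) (w.rep 1) = 0}

theorem mk_mem_zeros {w : Fin 2 → ℂ} (hw : w ≠ 0) :
    Projectivization.mk ℂ w hw ∈ D.zeros ↔ D.eval (w 0) (w 1) = 0 := by
  obtain ⟨k, hk⟩ := Projectivization.exists_smul_eq_mk_rep ℂ w hw
  rw [zeros, Set.mem_ofPred_eq, ← hk, Units.smul_def]
  simp [eval_smul]

theorem smul_image_zeros {D D' : BinaryQuartic} (g : Matrix.SpecialLinearGroup (Fin 2) ℂ) (k : ℂ)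
    (hk : k ≠ 0)
    (h : ∀ x y, D'.eval x y = k * D.eval (g.1 0 0 * x + g.1 0 1 * y) (g.1 1 0 * x + g.1 1 1 * y)) :
    (fun w : CP1 => g • w) '' D'.zeros = D.zeros := by
  have key : ∀ w : CP1, g • w ∈ D.zeros ↔ w ∈ D'.zeros := fun w => by
    induction w using Projectivization.ind with
    | h v hv =>
      rw [Projectivization.smul_mk, mk_mem_zeros, mk_mem_zeros, h]
      have : g • v = g.1.mulVec v := rfl
      simp [this, Matrix.mulVec, dotProduct, Fin.sum_univ_two, hk]
  ext w
  constructor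
  · rintro ⟨v, hv, rfl⟩
    exact (key v).2 hv
  · intro hw
    exact ⟨g⁻¹ • w, (key _).1 (by simpa using hw), by simp⟩

/-- The zero sets of two binary quartic forms are equivalent under `SL(2)`. -/
def ZerosEquiv (D D' : BinaryQuartic) : Prop :=
  ∃ g : Matrix.SpecialLinearGroup (Fin 2) ℂ, (fun w : CP1 => g • w) '' D.zeros = D'.zeros

theorem ZerosEquiv.symm {D D' : BinaryQuartic} (h : ZerosEquiv D D') : ZerosEquiv D' D := by
  obtain ⟨g, hg⟩ := h
  exact ⟨g⁻¹, by rw [← hg, Set.image_image]; simp⟩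

theorem ZerosEquiv.trans {D D' D'' : BinaryQuartic} (h : ZerosEquiv D D')
    (h' : ZerosEquiv D' D'') : ZerosEquiv D D'' := by
  obtain ⟨g, hg⟩ := h
  obtain ⟨g', hg'⟩ := h'
  exact ⟨g' * g, by rw [← hg', ← hg, Set.image_image]; simp [mul_smul]⟩

theorem ZerosEquiv.ncard_eq {D D' : BinaryQuartic} (h : ZerosEquiv D D') :
    D.zeros.ncard = D'.zeros.ncard := by
  obtain ⟨g, hg⟩ := h
  rw [← hg, Set.ncard_image_of_injective _ (MulAction.injective g)]

/-- Dividing an invertible substitution by a square root k of its determinant puts it in SL(2), and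
only rescales the form by a power of k. -/
theorem zerosEquiv_of_eval_eq {D D' : BinaryQuartic} {p q r s : ℂ} (h : p * s - q * r ≠ 0)
    (hD : ∀ x y, D'.eval x y = D.eval (p * x + q * y) (r * x + s * y)) : ZerosEquiv D' D := by
  obtain ⟨k, hk⟩ := IsAlgClosed.exists_pow_nat_eq (p * s - q * r) (n := 2) (by norm_num)
  have hk0 : k ≠ 0 := by rintro rfl; exact h (by simp [← hk])
  refine ⟨⟨!![p / k, q / k; r / k, s / k], ?_⟩, smul_image_zeros _ (k ^ 4) (by simp [hk0]) ?_⟩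
  · rw [Matrix.det_fin_two_of]
    field_simp
    rw [hk]
  · intro x y
    rw [hD, ← eval_smul]
    congr 1 <;> simp <;> field_simp

theorem zerosEquiv_comp {p q r s : ℂ} (h : p * s - q * r = 1) :
    ZerosEquiv (D.comp p q r s) D :=
  zerosEquiv_of_eval_eq (by simp [h]) (D.comp_eval p q r s)

theorem exists_zero : ∃ x y, D.eval x y = 0 ∧ (x ≠ 0 ∨ y ≠ 0) := by
  by_cases ha : D.a = 0
  · exact ⟨1, 0, by simp [eval, ha], by simp⟩
  · let P : Polynomial ℂ := .C D.a * .X ^ 4 + .C D.b * .X ^ 3 + .C D.c * .X ^ 2 + .C D.d * .X + .C D.e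
    have hP : P.degree ≠ 0 := by
      have : P.degree = 4 := by
        simp only [P]; compute_degree!
      simp [this]
    obtain ⟨x, hx⟩ := IsAlgClosed.exists_root P hP
    refine ⟨x, 1, ?_, by simp⟩
    simpa [P, eval] using hx

/-- A quartic form with simple zeros can be moved to have a simple zero at infinity. -/
theorem Nonsingular.exists_comp_a_eq_zero {D : BinaryQuartic} (hD : D.Nonsingular) :
    ∃ p q r s, p * s - q * r = 1 ∧ (D.comp p q r s).a = 0 ∧ (D.comp p q r s).b ≠ 0 := by
  obtain ⟨x, y, h0, hxy⟩ := D.exists_zero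
  obtain ⟨q, s, h⟩ : ∃ q s, x * s - q * y = 1 := by
    rcases hxy with h | h
    · exact ⟨0, x⁻¹, by simp [h]⟩
    · exact ⟨-y⁻¹, 0, by simp [h]⟩
  have ha : (D.comp x q y s).a = 0 := h0
  refine ⟨x, q, y, s, h, ha, fun hb => ?_⟩
  have := (hD.comp h) 1 0 (by simpa [eval] using ha) (by simpa [dx] using ha)
    (by simpa [dy] using hb)
  simp at this

/-- The normal form of a quartic form with simple zeros, by its invariants. -/
theorem Nonsingular.zerosEquiv_normalForm {D : BinaryQuartic} (hD : D.Nonsingular) :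
    ZerosEquiv D ⟨0, 1, 0, -D.invI / 3, -D.invJ / 27⟩ := by
  obtain ⟨p, q, r, s, h, ha, hb⟩ := hD.exists_comp_a_eq_zero
  have hI := D.comp_invI p q r s
  have hJ := D.comp_invJ p q r s
  refine (D.zerosEquiv_comp h).symm.trans ?_
  rw [h] at hI hJ
  revert ha hb hI hJ
  generalize D.comp p q r s = E
  intro ha hb hI hJ
  obtain ⟨k, hk⟩ := IsAlgClosed.exists_pow_nat_eq E.b (n := 2) (by norm_num)
  have hk0 : k ≠ 0 := by rintro rfl; exact hb (by simp [← hk])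
  -- With k² = b, this unimodular substitution makes the coefficient of x³y equal to 1 and completes
  -- the cube, removing x²y². For the result, I = −3d and J = −27e, so the invariants give back the
  -- last two coefficients.
  refine (zerosEquiv_of_eval_eq (p := k⁻¹) (q := - E.c / (3 * E.b) * k) (r := 0) (s := k)
    (by simp [hk0]) ?_).symm
  intro x y
  have hI' : D.invI = E.invI := by rw [hI]; ring
  have hJ' : D.invJ = E.invJ := by rw [hJ]; ring
  rw [hI', hJ']
  simp only [eval, invI, invJ, ha, ← hk]
  field_simp
  ring

theorem zerosEquiv_of_invariants {D E : BinaryQuartic} (hD : D.Nonsingular) (hE : E.Nonsingular)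
    (hI : D.invI = E.invI) (hJ : D.invJ = E.invJ) : ZerosEquiv D E := by
  have h := hD.zerosEquiv_normalForm
  rw [hI, hJ] at h
  exact h.trans hE.zerosEquiv_normalForm.symm

theorem mk_one_injective : Function.Injective
    (fun x : ℂ => (Projectivization.mk ℂ ![x, 1] (by simp) : CP1)) := by
  intro x y h
  obtain ⟨k, hk⟩ := (Projectivization.mk_eq_mk_iff' ℂ _ _ _ _).1 h
  have h0 := congr_fun hk 0
  have h1 := congr_fun hk 1
  simp only [Pi.smul_apply, smul_eq_mul, Matrix.cons_val_zero, Matrix.cons_val_one] at h0 h1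
  rw [← h0]
  linear_combination y * h1

/-- Every point of the line is `[x : 1]` or `[1 : 0]`. -/
theorem eq_mk_one_or_eq_infty (w : CP1) :
    (∃ x : ℂ, w = Projectivization.mk ℂ ![x, 1] (by simp)) ∨
      w = Projectivization.mk ℂ ![1, 0] (by simp) := by
  induction w using Projectivization.ind with
  | h v hv =>
    by_cases h : v 1 = 0
    · right
      rw [Projectivization.mk_eq_mk_iff']
      exact ⟨v 0, by ext i; fin_cases i <;> simp [h]⟩
    · left
      refine ⟨v 0 / v 1, (Projectivization.mk_eq_mk_iff' ℂ _ _ _ _).2 ⟨v 1, ?_⟩⟩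
      ext i; fin_cases i <;> simp [h, mul_div_cancel₀]

theorem infty_ne_mk_one (x : ℂ) :
    (Projectivization.mk ℂ ![1, 0] (by simp) : CP1) ≠ Projectivization.mk ℂ ![x, 1] (by simp) := by
  intro h
  obtain ⟨k, hk⟩ := (Projectivization.mk_eq_mk_iff' ℂ _ _ _ _).1 h
  have h0 := congr_fun hk 0
  have h1 := congr_fun hk 1
  simp at h0 h1
  simp [h1] at h0

/-- With one zero moved to infinity, the others are the roots of a cubic polynomial P. At a double
root of P, Euler's identity would make both partial derivatives of the form vanish, so P is
separable and has three roots. -/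
theorem Nonsingular.ncard_zeros {D : BinaryQuartic} (hD : D.Nonsingular) : D.zeros.ncard = 4 := by
  obtain ⟨p, q, r, s, h, ha, hb⟩ := hD.exists_comp_a_eq_zero
  rw [← (D.zerosEquiv_comp h).ncard_eq]
  have hE := hD.comp h
  revert ha hb hE
  generalize D.comp p q r s = E
  intro ha hb hE
  let P : Polynomial ℂ := .C E.b * .X ^ 3 + .C E.c * .X ^ 2 + .C E.d * .X + .C E.e
  have hP : P.natDegree = 3 := by simp only [P]; compute_degree!
  have hP0 : P ≠ 0 := by intro h; simp [h] at hP
  have hev : ∀ x, P.eval x = E.eval x 1 := fun x => by simp [P, eval, ha]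
  have hsep : P.Separable := by
    rw [Polynomial.separable_def, Polynomial.isCoprime_iff_aeval_ne_zero_of_isAlgClosed ℂ ℂ]
    intro x
    by_contra! hx
    have h0 : E.eval x 1 = 0 := by rw [← hev]; simpa using hx.1
    have hx1 : E.dx x 1 = 0 := by
      rw [← hx.2]; simp [P, dx, ha]; ring
    have := E.euler x 1
    have := hE x 1 h0 hx1 (by linear_combination this + 4 * h0 - x * hx1)
    simp at this
  have hcard : P.roots.toFinset.card = 3 := by
    rw [Multiset.toFinset_card_of_nodup (Polynomial.nodup_roots hsep), ← hP]
    exact (IsAlgClosed.splits P).natDegree_eq_card_roots.symm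
  have hz : E.zeros = insert (Projectivization.mk ℂ ![1, 0] (by simp))
      ((fun x : ℂ => (Projectivization.mk ℂ ![x, 1] (by simp) : CP1)) '' P.roots.toFinset) := by
    ext w
    rcases eq_mk_one_or_eq_infty w with ⟨x, rfl⟩ | rfl
    · rw [mk_mem_zeros, Set.mem_insert_iff, mk_one_injective.mem_set_image]
      simp [hP0, hev, (infty_ne_mk_one x).symm]
    · rw [mk_mem_zeros]
      simp [eval, ha]
  rw [hz, Set.ncard_insert_of_notMem, Set.ncard_image_of_injective _ mk_one_injective,
    Set.ncard_coe_finset, hcard]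
  rintro ⟨x, -, hx⟩
  exact infty_ne_mk_one x hx.symm

end BinaryQuartic

/-! ### Zeros of binary quadratic forms -/

/-- The number of zeros on the projective line of a nonzero binary quadratic form. -/
theorem ncard_zeros_binaryQuadratic {a b c : ℂ} (h : ¬(a = 0 ∧ b = 0 ∧ c = 0)) :
    {w : CP1 | a * w.rep 0 ^ 2 + b * w.rep 0 * w.rep 1 + c * w.rep 1 ^ 2 = 0}.ncard =
      if b ^ 2 - 4 * a * c = 0 then 1 else 2 := by
  set S := {w : CP1 | a * w.rep 0 ^ 2 + b * w.rep 0 * w.rep 1 + c * w.rep 1 ^ 2 = 0} with hS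
  have hmem : ∀ (v : Fin 2 → ℂ) (hv : v ≠ 0), Projectivization.mk ℂ v hv ∈ S ↔
      a * v 0 ^ 2 + b * v 0 * v 1 + c * v 1 ^ 2 = 0 := fun v hv => by
    obtain ⟨k, hk⟩ := Projectivization.exists_smul_eq_mk_rep ℂ v hv
    rw [hS, Set.mem_ofPred_eq, ← hk, Units.smul_def]
    have : a * (k.1 • v) 0 ^ 2 + b * (k.1 • v) 0 * (k.1 • v) 1 + c * (k.1 • v) 1 ^ 2 =
      k.1 ^ 2 * (a * v 0 ^ 2 + b * v 0 * v 1 + c * v 1 ^ 2) := by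
        simp only [Pi.smul_apply, smul_eq_mul]; ring
    rw [this]
    simp
  let pt : ℂ → CP1 := fun x : ℂ => Projectivization.mk ℂ ![x, 1] (by simp)
  let inf : CP1 := Projectivization.mk ℂ ![1, 0] (by simp)
  have hpt : ∀ x, pt x ∈ S ↔ a * x ^ 2 + b * x + c = 0 := fun x => by simp [pt, hmem]
  have hinf : inf ∈ S ↔ a = 0 := by simp [inf, hmem]
  have hinj : Function.Injective pt := BinaryQuartic.mk_one_injective
  have hne : ∀ x, inf ≠ pt x := BinaryQuartic.infty_ne_mk_one
  have hcases : ∀ w, (∃ x, w = pt x) ∨ w = inf := BinaryQuartic.eq_mk_one_or_eq_infty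
  by_cases ha : a = 0
  · subst ha
    by_cases hb : b = 0
    · subst hb
      have hc : c ≠ 0 := by simpa using h
      rw [if_pos (by simp), Set.ncard_eq_one]
      refine ⟨inf, Set.ext fun w => ?_⟩
      rcases hcases w with ⟨x, rfl⟩ | rfl
      · simp [hpt, hc, (hne x).symm]
      · simp [hinf]
    · rw [if_neg (by simpa using hb), Set.ncard_eq_two]
      refine ⟨inf, pt (-c / b), hne _, Set.ext fun w => ?_⟩
      rcases hcases w with ⟨x, rfl⟩ | rfl
      · simp only [hpt, Set.mem_insert_iff, Set.mem_singleton_iff, (hne x).symm, hinj.eq_iff,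
          false_or, eq_div_iff hb]
        constructor <;> intro h <;> linear_combination h
      · simp [hinf]
  · obtain ⟨k, hk⟩ := IsAlgClosed.exists_pow_nat_eq (b ^ 2 - 4 * a * c) (n := 2) (by norm_num)
    have hroot : ∀ x, pt x ∈ S ↔ x = (-b + k) / (2 * a) ∨ x = (-b - k) / (2 * a) := fun x => by
      rw [hpt, eq_div_iff (by simpa using ha), eq_div_iff (by simpa using ha),
        ← sub_eq_zero (b := -b + k), ← sub_eq_zero (b := -b - k), ← mul_eq_zero]
      constructor
      · intro h; linear_combination 4 * a * h - hk
      · intro h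
        have : 4 * a * (a * x ^ 2 + b * x + c) = 0 := by linear_combination h + hk
        simpa [ha] using this
    split_ifs with hd
    · have hk0 : k = 0 := by simpa [hd] using hk
      rw [Set.ncard_eq_one]
      refine ⟨pt (-b / (2 * a)), Set.ext fun w => ?_⟩
      rcases hcases w with ⟨x, rfl⟩ | rfl
      · simp [hroot, hk0, hinj.eq_iff]
      · simp [hinf, ha, hne]
    · have hk0 : k ≠ 0 := by rintro rfl; exact hd (by simp [← hk])
      rw [Set.ncard_eq_two]
      refine ⟨pt ((-b + k) / (2 * a)), pt ((-b - k) / (2 * a)), fun h => hk0 ?_,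
        Set.ext fun w => ?_⟩
      · have := hinj h
        field_simp at this
        linear_combination this / 2
      · rcases hcases w with ⟨x, rfl⟩ | rfl
        · simp [hroot, hinj.eq_iff]
        · simp [hinf, ha, hne]

/-! ### The discriminant quartic of a pointed cubic -/

namespace PointedCubic

variable (F : PointedCubic)

/-- The quartic form whose zeros are the tangent directions of the lines through `(0 : 0 : 1)` that
meet the cubic in a double residual point. -/
def disc : BinaryQuartic where
  a := F.q0 ^ 2 - 4 * (F.l0 * F.c0)
  b := 2 * F.q0 * F.q1 - 4 * (F.l0 * F.c1 + F.l1 * F.c0)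
  c := F.q1 ^ 2 + 2 * F.q0 * F.q2 - 4 * (F.l0 * F.c2 + F.l1 * F.c1)
  d := 2 * F.q1 * F.q2 - 4 * (F.l0 * F.c3 + F.l1 * F.c2)
  e := F.q2 ^ 2 - 4 * (F.l1 * F.c3)

theorem disc_eval (x y : ℂ) :
    F.disc.eval x y = F.quad x y ^ 2 - 4 * F.lin x y * F.cub x y := by
  simp only [BinaryQuartic.eval, disc, lin, quad, cub]; ring

/-- The x-derivative of the identity `disc_eval_eq`; z is a free parameter, to be placed at a double
root. -/
theorem disc_dx (x y z : ℂ) :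
    F.disc.dx x y = 2 * F.dz x y z * (2 * z * F.l0 + 2 * F.q0 * x + F.q1 * y) -
      4 * F.lin x y * F.dx x y z - 4 * F.l0 * F.eval x y z := by
  simp only [BinaryQuartic.dx, disc, lin, quad, cub, eval, dx, dz]; ring

theorem disc_dy (x y z : ℂ) :
    F.disc.dy x y = 2 * F.dz x y z * (2 * z * F.l1 + F.q1 * x + 2 * F.q2 * y) -
      4 * F.lin x y * F.dy x y z - 4 * F.l1 * F.eval x y z := by
  simp only [BinaryQuartic.dy, disc, lin, quad, cub, eval, dy, dz]; ring

theorem disc_eval_eq (x y z : ℂ) :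
    F.disc.eval x y = F.dz x y z ^ 2 - 4 * F.lin x y * F.eval x y z := by
  rw [disc_eval]; simp only [eval, dz]; ring

variable {F}

theorem Smooth.lin_ne_zero (hF : F.Smooth) : ¬(F.l0 = 0 ∧ F.l1 = 0) := fun ⟨h0, h1⟩ => by
  have := hF 0 0 1 (by simp [eval, lin, quad, cub]) (by simp [dx, h0]) (by simp [dy, h1])
    (by simp [dz, lin, quad])
  simp at this

theorem exists_quadratic_root {a b c : ℂ} (ha : a ≠ 0) : ∃ z, z ^ 2 * a + z * b + c = 0 := by
  obtain ⟨k, hk⟩ := IsAlgClosed.exists_pow_nat_eq (b ^ 2 - 4 * a * c) (n := 2) (by norm_num)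
  refine ⟨(-b + k) / (2 * a), ?_⟩
  field_simp
  linear_combination hk

/-- A smooth cubic contains no line through `(0 : 0 : 1)`. -/
theorem Smooth.eq_zero_of_line (hF : F.Smooth) {x y : ℂ} (hl : F.lin x y = 0)
    (hq : F.quad x y = 0) (hc : F.cub x y = 0) : x = 0 ∧ y = 0 := by
  have he : ∀ z, F.eval x y z = 0 := fun z => by simp [eval, hl, hq, hc]
  have hz : ∀ z, F.dz x y z = 0 := fun z => by simp [dz, hl, hq]
  have heu : ∀ z, x * F.dx x y z + y * F.dy x y z = 0 := fun z => by
    simpa [he, hz] using F.euler x y z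
  have hL := hF.lin_ne_zero
  simp only [lin] at hl
  -- On the line, f and its z-derivative vanish identically, and Euler's identity makes the two
  -- remaining partials dependent. One of them is a quadratic in z with leading coefficient l0 or
  -- l1, nonzero in the respective case; its root would be a singular point.
  by_cases hx : x = 0
  · by_cases hy : y = 0
    · exact ⟨hx, hy⟩
    · have hl1 : F.l1 = 0 := by simpa [hx, hy] using hl
      obtain ⟨z, hz'⟩ := exists_quadratic_root (a := F.l0) (b := 2 * F.q0 * x + F.q1 * y)
        (c := 3 * F.c0 * x ^ 2 + 2 * F.c1 * x * y + F.c2 * y ^ 2) (fun h => hL ⟨h, hl1⟩)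
      have := hF x y z (he z) hz' (by simpa [hx, hy] using heu z) (hz z)
      exact ⟨this.1, this.2.1⟩
  · have hl1 : F.l1 ≠ 0 := fun h => hL ⟨by simpa [h, hx] using hl, h⟩
    obtain ⟨z, hz'⟩ := exists_quadratic_root (b := F.q1 * x + 2 * F.q2 * y)
      (c := F.c1 * x ^ 2 + 2 * F.c2 * x * y + 3 * F.c3 * y ^ 2) hl1
    have hdy : F.dy x y z = 0 := hz'
    have := hF x y z (he z) (by simpa [hx, hdy] using heu z) hdy (hz z)
    exact ⟨this.1, this.2.1⟩

/-- If L ≠ 0 at a multiple zero, the double root z of the residual quadratic is a singular point of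
the cubic. If L = 0, then Q = 0 as well, and the vanishing derivatives force C = 0, so the cubic
contains the line. -/
theorem Smooth.disc_nonsingular (hF : F.Smooth) : F.disc.Nonsingular := by
  intro x y h0 hx hy
  by_cases hl : F.lin x y = 0
  · have hq : F.quad x y = 0 := by simpa [disc_eval, hl] using h0
    have hz : F.dz x y 0 = 0 := by simp [dz, hq]
    rw [F.disc_dx x y 0, hl, hz] at hx
    rw [F.disc_dy x y 0, hl, hz] at hy
    have hc : F.eval x y 0 = 0 := by
      by_contra hc
      exact hF.lin_ne_zero ⟨by simpa [hc] using hx, by simpa [hc] using hy⟩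
    exact hF.eq_zero_of_line hl hq (by simpa [eval] using hc)
  · obtain ⟨z, hz⟩ : ∃ z, F.dz x y z = 0 :=
      ⟨-F.quad x y / (2 * F.lin x y), by simp only [dz]; field_simp; ring⟩
    have he : F.eval x y z = 0 := by simpa [F.disc_eval_eq x y z, hz, hl] using h0
    rw [F.disc_dx x y z, hz, he] at hx
    rw [F.disc_dy x y z, hz, he] at hy
    have := hF x y z he (by simpa [hl] using hx) (by simpa [hl] using hy) hz
    exact ⟨this.1, this.2.1⟩

end PointedCubic

/-! ### Coordinates adapted to the projection -/

theorem basis_sum_three (b : Module.Basis (Fin 3) ℂ (Fin 3 → ℂ)) (v : Fin 3 → ℂ) :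
    b.repr v 0 • b 0 + b.repr v 1 • b 1 + b.repr v 2 • b 2 = v := by
  rw [← Fin.sum_univ_three fun i => b.repr v i • b i, b.sum_repr]

/-- A basis of `ℂ³` adapted to a linear map `ℓ` whose kernel is the line `p`. -/
structure IsAdapted (p : CP2) (ℓ : (Fin 3 → ℂ) →ₗ[ℂ] (Fin 2 → ℂ))
    (b : Module.Basis (Fin 3) ℂ (Fin 3 → ℂ)) : Prop where
  apply_two : b 2 = p.rep
  map_zero : ∀ v, ℓ v 0 = b.repr v 0
  map_one : ∀ v, ℓ v 1 = b.repr v 1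

theorem mem_ker_iff {p : CP2} {ℓ : (Fin 3 → ℂ) →ₗ[ℂ] (Fin 2 → ℂ)}
    (h : LinearMap.ker ℓ = p.submodule) (v : Fin 3 → ℂ) : ℓ v = 0 ↔ ∃ c : ℂ, c • p.rep = v := by
  rw [← LinearMap.mem_ker, h, Projectivization.submodule_eq, Submodule.mem_span_singleton]

theorem exists_isAdapted {p : CP2} {ℓ : (Fin 3 → ℂ) →ₗ[ℂ] (Fin 2 → ℂ)}
    (h : LinearMap.ker ℓ = p.submodule) : ∃ b, IsAdapted p ℓ b := by
  have hsurj : Function.Surjective ℓ := by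
    rw [← LinearMap.range_eq_top]
    apply Submodule.eq_top_of_finrank_eq
    have := ℓ.finrank_range_add_finrank_ker
    rw [h, Projectivization.finrank_submodule] at this
    simp only [Module.finrank_fin_fun] at this ⊢
    omega
  obtain ⟨e0, h0⟩ := hsurj ![1, 0]
  obtain ⟨e1, h1⟩ := hsurj ![0, 1]
  have h2 : ℓ p.rep = 0 := (mem_ker_iff h _).2 ⟨1, one_smul _ _⟩
  have hli : LinearIndependent ℂ ![e0, e1, p.rep] := by
    rw [Fintype.linearIndependent_iff]
    intro g hg
    simp only [Fin.sum_univ_three, Matrix.cons_val_zero, Matrix.cons_val_one, Matrix.cons_val] at hg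
    have hl := congr_arg ℓ hg
    simp only [_root_.map_add, map_smul, h0, h1, h2, _root_.map_zero] at hl
    have g0 : g 0 = 0 := by simpa using congr_fun hl 0
    have g1 : g 1 = 0 := by simpa using congr_fun hl 1
    have g2 : g 2 = 0 := by simpa [g0, g1, p.rep_nonzero] using hg
    intro i; fin_cases i <;> assumption
  let b := basisOfLinearIndependentOfCardEqFinrank hli (by simp)
  have hb : ⇑b = ![e0, e1, p.rep] := coe_basisOfLinearIndependentOfCardEqFinrank hli (by simp)
  have hv : ∀ v, ℓ v = ![b.repr v 0, b.repr v 1] := fun v => by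
    conv_lhs => rw [← b.sum_repr v]
    simp [Fin.sum_univ_three, hb, h0, h1, h2]
  exact ⟨b, by simp [hb], fun v => by simp [hv], fun v => by simp [hv]⟩

/-- A linear functional as a linear form. -/
noncomputable def linearForm (g : (Fin 3 → ℂ) →ₗ[ℂ] ℂ) : MvPolynomial (Fin 3) ℂ :=
  ∑ j, C (g (Pi.single j 1)) * X j

theorem linearForm_isHomogeneous (g : (Fin 3 → ℂ) →ₗ[ℂ] ℂ) : (linearForm g).IsHomogeneous 1 :=
  IsHomogeneous.sum _ _ _ fun j _ => by
    simpa using (isHomogeneous_C (Fin 3) (g (Pi.single j 1))).mul (isHomogeneous_X ℂ j)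

theorem eval_linearForm (g : (Fin 3 → ℂ) →ₗ[ℂ] ℂ) (v : Fin 3 → ℂ) :
    eval v (linearForm g) = g v := by
  conv_rhs => rw [← Finset.univ_sum_single v, map_sum]
  simp only [linearForm, map_sum, map_mul, eval_C, eval_X]
  refine Finset.sum_congr rfl fun j _ => ?_
  rw [mul_comm, ← smul_eq_mul, ← map_smul, ← Pi.single_smul]
  simp

theorem polyDiff_linearForm (g : (Fin 3 → ℂ) →ₗ[ℂ] ℂ) (u v : Fin 3 → ℂ) :
    polyDiff (linearForm g) u v = g v := by
  rw [← eval_linearForm]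
  simp only [linearForm, polyDiff, Fin.sum_univ_three, map_add, map_mul, eval_C, eval_X,
    Derivation.leibniz, pderiv_X, pderiv_C, smul_eq_mul]
  simp
  ring

variable {f : MvPolynomial (Fin 3) ℂ} {p : planeCurve f}
  {ℓ : (Fin 3 → ℂ) →ₗ[ℂ] (Fin 2 → ℂ)} {φ : planeCurve f → CP1}
  {b : Module.Basis (Fin 3) ℂ (Fin 3 → ℂ)} {F : PointedCubic}

namespace IsAdapted

theorem apply_rep (hb : IsAdapted p.1 ℓ b) :
    b.repr p.1.rep 0 = 0 ∧ b.repr p.1.rep 1 = 0 ∧ b.repr p.1.rep 2 = 1 := by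
  simp [← hb.apply_two]

theorem apply_eq_zero_iff (hb : IsAdapted p.1 ℓ b) (v : Fin 3 → ℂ) :
    ℓ v = 0 ↔ b.repr v 0 = 0 ∧ b.repr v 1 = 0 := by
  rw [← hb.map_zero, ← hb.map_one]
  exact ⟨fun h => by simp [h], fun ⟨h, h'⟩ => by ext i; fin_cases i <;> assumption⟩

theorem eq_of_apply_eq_zero (hb : IsAdapted p.1 ℓ b) {x : planeCurve f} (hx : ℓ x.1.rep = 0) :
    x = p := by
  rw [hb.apply_eq_zero_iff] at hx
  apply Subtype.ext
  rw [← Projectivization.mk_rep x.1, ← Projectivization.mk_rep p.1,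
    Projectivization.mk_eq_mk_iff']
  refine ⟨b.repr x.1.rep 2, ?_⟩
  have := basis_sum_three b x.1.rep
  rwa [hx.1, hx.2, zero_smul, zero_smul, zero_add, zero_add, hb.apply_two] at this

theorem apply_center (hb : IsAdapted p.1 ℓ b) : ℓ p.1.rep = 0 := by
  rw [hb.apply_eq_zero_iff]; exact ⟨hb.apply_rep.1, hb.apply_rep.2.1⟩

end IsAdapted

theorem IsExpansion.exists_polyDiff_ne_zero (hE : IsExpansion f b F) (hF : F.Smooth)
    (x : planeCurve f) : ∃ w, polyDiff f x.1.rep w ≠ 0 := by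
  by_contra! h
  have h0 := h (b 0)
  have h1 := h (b 1)
  have h2 := h (b 2)
  simp only [hE.polyDiff_eq, b.repr_self, Finsupp.single_apply] at h0 h1 h2
  obtain ⟨hx, hy, hz⟩ := hF _ _ _ ((hE _).symm.trans x.2) (by simpa using h0) (by simpa using h1)
    (by simpa using h2)
  apply x.1.rep_nonzero
  rw [← basis_sum_three b x.1.rep, hx, hy, hz]
  simp

/-! ### The projection near its centre, existence and uniqueness -/

/-- The tangent direction of the cubic at `(0 : 0 : 1)`. -/
theorem PointedCubic.Smooth.tangent_ne_zero (hF : F.Smooth) : ![-F.l1, F.l0] ≠ 0 := by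
  rw [ne_zero_of_fin_two]
  have := hF.lin_ne_zero
  simp only [Matrix.cons_val_zero, Matrix.cons_val_one, ne_eq, neg_eq_zero]
  tauto

/-- The linear forms of the projection represent it away from the center. -/
theorem IsAdapted.representsAt (hb : IsAdapted p.1 ℓ b)
    (hφ : ∀ (x : planeCurve f) (hx : ℓ x.1.rep ≠ 0), φ x = Projectivization.mk ℂ (ℓ x.1.rep) hx)
    {x : planeCurve f} (hx : ℓ x.1.rep ≠ 0) :
    RepresentsAt f φ x (linearForm (b.coord 0)) (linearForm (b.coord 1)) := by
  have key : ∀ y, ![eval y (linearForm (b.coord 0)), eval y (linearForm (b.coord 1))] = ℓ y :=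
    fun y => by
      ext i; fin_cases i <;> simp [eval_linearForm, hb.map_zero, hb.map_one]
  refine ⟨⟨1, linearForm_isHomogeneous _, linearForm_isHomogeneous _⟩, by rwa [key], ?_⟩
  intro y hy
  simp only [key] at hy ⊢
  exact hφ y hy

/-- If [A : B] represents the map at p, then Ay − Bx vanishes on the curve. Since x = y = 0 at p,
its differential along the tangent vector (−l1, l0) is A(p) l0 + B(p) l1, which must be zero. -/
theorem IsProjectionFrom.apply_center (hφ : IsProjectionFrom f p ℓ φ) (hf : f.IsHomogeneous 3)
    (hb : IsAdapted p.1 ℓ b) (hE : IsExpansion f b F) (hF : F.Smooth) :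
    φ p = Projectivization.mk ℂ ![-F.l1, F.l0] hF.tangent_ne_zero := by
  obtain ⟨A, B, h⟩ := hφ.isMorphism p
  obtain ⟨d, hA, hB⟩ := h.same_degree
  rw [h.apply_eq p h.ne_zero, cross_eq_zero_iff_mk_eq_mk]
  obtain ⟨h0, h1, h2⟩ := hb.apply_rep
  have hvan : ∀ y : planeCurve f,
      eval y.1.rep (A * linearForm (b.coord 1) - B * linearForm (b.coord 0)) = 0 := fun y => by
    by_cases hy : ℓ y.1.rep = 0
    · rw [hb.apply_eq_zero_iff] at hy
      simp [eval_linearForm, hy]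
    · exact h.cross_eq_zero (hb.representsAt hφ.apply_eq hy) y
  obtain ⟨w, hw⟩ := hE.exists_polyDiff_ne_zero hF p
  have hG := polyDiff_eq_zero_of_vanishing (v := -F.l1 • b 0 + F.l0 • b 1)
    (eval_eq_zero_of_forall_planeCurve hf
    ((hA.mul (linearForm_isHomogeneous _)).sub (hB.mul (linearForm_isHomogeneous _))) hvan)
    p.1.rep_nonzero p.2 hw (by
      simp [hE.polyDiff_eq, h0, h1, h2, PointedCubic.dx, PointedCubic.dy]; ring)
  simp only [polyDiff_sub, polyDiff_mul, eval_linearForm, polyDiff_linearForm] at hG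
  simp [h0, h1] at hG
  simp only [Matrix.cons_val_zero, Matrix.cons_val_one]
  linear_combination hG

/-- The quadratic forms `A`, `B` with `f = x B - y A`: the first one. -/
noncomputable def centerFormFst (b : Module.Basis (Fin 3) ℂ (Fin 3 → ℂ)) (F : PointedCubic) :
    MvPolynomial (Fin 3) ℂ :=
  -(C F.l1 * (linearForm (b.coord 2) * linearForm (b.coord 2)) +
    C F.q2 * (linearForm (b.coord 2) * linearForm (b.coord 1)) +
    C F.c3 * (linearForm (b.coord 1) * linearForm (b.coord 1)))

/-- The quadratic forms `A`, `B` with `f = x B - y A`: the second one. -/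
noncomputable def centerFormSnd (b : Module.Basis (Fin 3) ℂ (Fin 3 → ℂ)) (F : PointedCubic) :
    MvPolynomial (Fin 3) ℂ :=
  C F.l0 * (linearForm (b.coord 2) * linearForm (b.coord 2)) +
    C F.q0 * (linearForm (b.coord 2) * linearForm (b.coord 0)) +
    C F.q1 * (linearForm (b.coord 2) * linearForm (b.coord 1)) +
    C F.c0 * (linearForm (b.coord 0) * linearForm (b.coord 0)) +
    C F.c1 * (linearForm (b.coord 0) * linearForm (b.coord 1)) +
    C F.c2 * (linearForm (b.coord 1) * linearForm (b.coord 1))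

theorem isHomogeneous_C_mul_linearForm_mul (c : ℂ) (g h : (Fin 3 → ℂ) →ₗ[ℂ] ℂ) :
    (C c * (linearForm g * linearForm h)).IsHomogeneous 2 := by
  simpa using (isHomogeneous_C (Fin 3) c).mul
    ((linearForm_isHomogeneous g).mul (linearForm_isHomogeneous h))

theorem centerForm_isHomogeneous (b : Module.Basis (Fin 3) ℂ (Fin 3 → ℂ)) (F : PointedCubic) :
    (centerFormFst b F).IsHomogeneous 2 ∧ (centerFormSnd b F).IsHomogeneous 2 := by
  have H := isHomogeneous_C_mul_linearForm_mul
  exact ⟨(((H _ _ _).add (H _ _ _)).add (H _ _ _)).neg,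
    (((((H _ _ _).add (H _ _ _)).add (H _ _ _)).add (H _ _ _)).add (H _ _ _)).add (H _ _ _)⟩

theorem IsExpansion.eval_eq_centerForm (hE : IsExpansion f b F) (v : Fin 3 → ℂ) :
    eval v f = b.repr v 0 * eval v (centerFormSnd b F) -
      b.repr v 1 * eval v (centerFormFst b F) := by
  rw [hE]
  simp only [centerFormSnd, centerFormFst, map_add, map_mul, map_neg, eval_C, eval_linearForm,
    Module.Basis.coord_apply, PointedCubic.eval, PointedCubic.lin, PointedCubic.quad,
    PointedCubic.cub]
  ring

theorem IsAdapted.eval_centerForm_center (hb : IsAdapted p.1 ℓ b) (F : PointedCubic) :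
    eval p.1.rep (centerFormFst b F) = -F.l1 ∧ eval p.1.rep (centerFormSnd b F) = F.l0 := by
  obtain ⟨h0, h1, h2⟩ := hb.apply_rep
  simp [centerFormFst, centerFormSnd, eval_linearForm, h0, h1, h2]

/-- A map given by `ℓ` away from the center and by the tangent direction at the center is
represented by quadratic forms at the center. -/
theorem IsExpansion.representsAt_center (hE : IsExpansion f b F) (hb : IsAdapted p.1 ℓ b)
    (hF : F.Smooth)
    (hφ : ∀ (x : planeCurve f) (hx : ℓ x.1.rep ≠ 0), φ x = Projectivization.mk ℂ (ℓ x.1.rep) hx)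
    (hp : φ p = Projectivization.mk ℂ ![-F.l1, F.l0] hF.tangent_ne_zero) :
    RepresentsAt f φ p (centerFormFst b F) (centerFormSnd b F) := by
  obtain ⟨hA, hB⟩ := hb.eval_centerForm_center F
  refine ⟨⟨2, centerForm_isHomogeneous b F⟩, by rw [hA, hB]; exact hF.tangent_ne_zero, ?_⟩
  intro y hy
  by_cases h : ℓ y.1.rep = 0
  · obtain rfl := hb.eq_of_apply_eq_zero h
    simp only [hp, hA, hB]
  · rw [hφ y h, cross_eq_zero_iff_mk_eq_mk]
    have := (hE.eval_eq_centerForm y.1.rep).symm.trans y.2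
    rw [hb.map_zero, hb.map_one]
    exact this

theorem existsUnique_isProjectionFrom (hf : f.IsHomogeneous 3) (hs : IsSmoothPlaneCurve f)
    (hℓ : LinearMap.ker ℓ = p.1.submodule) : ∃! φ, IsProjectionFrom f p ℓ φ := by
  obtain ⟨b, hb⟩ := exists_isAdapted hℓ
  obtain ⟨F, hE⟩ := exists_isExpansion hf b (by rw [hb.apply_two]; exact p.2)
  have hF := hE.smooth hf hs
  classical
  let φ : planeCurve f → CP1 := fun x =>
    if hx : ℓ x.1.rep ≠ 0 then Projectivization.mk ℂ (ℓ x.1.rep) hx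
    else Projectivization.mk ℂ ![-F.l1, F.l0] hF.tangent_ne_zero
  have hφ : ∀ (x : planeCurve f) (hx : ℓ x.1.rep ≠ 0),
    φ x = Projectivization.mk ℂ (ℓ x.1.rep) hx := fun x hx => dif_pos hx
  have hp : φ p = Projectivization.mk ℂ ![-F.l1, F.l0] hF.tangent_ne_zero :=
    dif_neg (not_not.2 hb.apply_center)
  refine ⟨φ, ⟨hℓ, fun x => ?_, hφ⟩, fun ψ hψ => funext fun x => ?_⟩
  · by_cases hx : ℓ x.1.rep = 0
    · obtain rfl := hb.eq_of_apply_eq_zero hx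
      exact ⟨_, _, hE.representsAt_center hb hF hφ hp⟩
    · exact ⟨_, _, hb.representsAt hφ hx⟩
  · by_cases hx : ℓ x.1.rep = 0
    · obtain rfl := hb.eq_of_apply_eq_zero hx
      rw [hp, hψ.apply_center hf hb hE hF]
    · rw [hφ x hx, hψ.apply_eq x hx]

/-! ### Ramification and fibres -/

namespace IsProjectionFrom

/-- The fibres of the projection, in coordinates. -/
theorem apply_eq_mk_iff (hφ : IsProjectionFrom f p ℓ φ) (hf : f.IsHomogeneous 3)
    (hb : IsAdapted p.1 ℓ b) (hE : IsExpansion f b F) (hF : F.Smooth) (x : planeCurve f)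
    {w : Fin 2 → ℂ} (hw : w ≠ 0) :
    φ x = Projectivization.mk ℂ w hw ↔
      b.repr x.1.rep 0 * w 1 - b.repr x.1.rep 1 * w 0 = 0 ∧
        (b.repr x.1.rep 0 = 0 → b.repr x.1.rep 1 = 0 → F.lin (w 0) (w 1) = 0) := by
  by_cases hx : ℓ x.1.rep = 0
  · have h := (hb.apply_eq_zero_iff _).1 hx
    obtain rfl := hb.eq_of_apply_eq_zero hx
    rw [hφ.apply_center hf hb hE hF, cross_eq_zero_iff_mk_eq_mk]
    simp only [h, PointedCubic.lin, Matrix.cons_val_zero, Matrix.cons_val_one]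
    constructor
    · intro h; exact ⟨by ring, fun _ _ => by linear_combination -h⟩
    · intro h; linear_combination -(h.2 trivial trivial)
  · rw [hφ.apply_eq x hx, cross_eq_zero_iff_mk_eq_mk, hb.map_zero, hb.map_one]
    rw [hb.apply_eq_zero_iff] at hx
    exact ⟨fun h => ⟨h, fun h0 h1 => absurd ⟨h0, h1⟩ hx⟩, And.left⟩

/-- Ramification asks for some representation; this allows it to be tested on whichever one is
convenient. -/
theorem isRamifiedAt_iff_of_representsAt {x : planeCurve f} {A B : MvPolynomial (Fin 3) ℂ}
    (hf : f.IsHomogeneous 3) (hE : IsExpansion f b F) (hF : F.Smooth)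
    (h : RepresentsAt f φ x A B) :
    IsRamifiedAt f φ x ↔ ∀ v : Fin 3 → ℂ, polyDiff f x.1.rep v = 0 →
      eval x.1.rep A * polyDiff B x.1.rep v - eval x.1.rep B * polyDiff A x.1.rep v = 0 := by
  obtain ⟨w, hw⟩ := hE.exists_polyDiff_ne_zero hF x
  constructor
  · rintro ⟨A', B', h', hv⟩ v hfv
    exact h'.differential_eq_zero hf h hw hfv (hv v hfv)
  · exact fun hv => ⟨A, B, h, hv⟩

/-- The projection is ramified at the points over the zeros of the discriminant. -/
theorem isRamifiedAt_iff (hφ : IsProjectionFrom f p ℓ φ) (hf : f.IsHomogeneous 3)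
    (hb : IsAdapted p.1 ℓ b) (hE : IsExpansion f b F) (hF : F.Smooth) (x : planeCurve f) :
    IsRamifiedAt f φ x ↔ φ x ∈ F.disc.zeros := by
  by_cases hx : ℓ x.1.rep = 0
  · have hp := hφ.apply_center hf hb hE hF
    obtain rfl := hb.eq_of_apply_eq_zero hx
    obtain ⟨h0, h1, h2⟩ := hb.apply_rep
    rw [isRamifiedAt_iff_of_representsAt hf hE hF (hE.representsAt_center hb hF hφ.apply_eq hp),
      hp, BinaryQuartic.mk_mem_zeros]
    obtain ⟨hA, hB⟩ := hb.eval_centerForm_center F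
    have hdisc : F.disc.eval (-F.l1) F.l0 = F.quad (-F.l1) F.l0 ^ 2 := by
      rw [F.disc_eval]
      simp only [PointedCubic.lin]; ring
    have hdiff : ∀ v, eval x.1.rep (centerFormFst b F) * polyDiff (centerFormSnd b F) x.1.rep v -
        eval x.1.rep (centerFormSnd b F) * polyDiff (centerFormFst b F) x.1.rep v =
        -F.l1 * F.q0 * b.repr v 0 + (F.l0 * F.q2 - F.l1 * F.q1) * b.repr v 1 := fun v => by
      rw [hA, hB]
      simp only [centerFormFst, centerFormSnd, polyDiff_add, polyDiff_neg, polyDiff_mul,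
        polyDiff_C, polyDiff_linearForm, eval_linearForm, Module.Basis.coord_apply, h0, h1, h2,
        eval_C, map_mul]
      ring
    simp only [hdiff, hE.polyDiff_eq, h0, h1, h2, Matrix.cons_val_zero, Matrix.cons_val_one, hdisc]
    simp only [PointedCubic.dx, PointedCubic.dy, PointedCubic.dz, PointedCubic.lin,
      PointedCubic.quad]
    constructor
    · intro h
      -- This vector spans the tangent plane of the cone together with p, and the differential takes
      -- on it the value Q(−l1, l0), whose square is the discriminant there.
      have := h (-F.l1 • b 0 + F.l0 • b 1) (by simp; ring)
      simp at this
      rw [sq_eq_zero_iff]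
      linear_combination this
    · intro h v hv
      have hq : F.q0 * F.l1 ^ 2 - F.q1 * F.l1 * F.l0 + F.q2 * F.l0 ^ 2 = 0 := by
        rw [sq_eq_zero_iff] at h
        linear_combination h
      have hv' : b.repr v 0 * F.l0 + b.repr v 1 * F.l1 = 0 := by linear_combination hv
      by_cases hl : F.l0 = 0
      · have hl1 : F.l1 ≠ 0 := fun h => hF.lin_ne_zero ⟨hl, h⟩
        apply mul_left_cancel₀ hl1
        linear_combination (-F.q1 * F.l1) * hv' - b.repr v 0 * hq +
          F.q2 * F.l0 * hv'
      · apply mul_left_cancel₀ hl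
        linear_combination (-F.l1 * F.q0) * hv' + b.repr v 1 * hq
  · rw [isRamifiedAt_iff_of_representsAt hf hE hF (hb.representsAt hφ.apply_eq hx),
      hφ.apply_eq x hx, BinaryQuartic.mk_mem_zeros, hb.map_zero, hb.map_one,
      F.disc_eval_eq _ _ (b.repr x.1.rep 2)]
    have he := (hE x.1.rep).symm.trans x.2
    simp only [eval_linearForm, polyDiff_linearForm, Module.Basis.coord_apply, hE.polyDiff_eq, he]
    rw [hb.apply_eq_zero_iff] at hx
    have heu := F.euler (b.repr x.1.rep 0) (b.repr x.1.rep 1) (b.repr x.1.rep 2)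
    have hsm := hF (b.repr x.1.rep 0) (b.repr x.1.rep 1) (b.repr x.1.rep 2) he
    rw [he] at heu
    generalize b.repr x.1.rep 0 = X at *
    generalize b.repr x.1.rep 1 = Y at *
    generalize b.repr x.1.rep 2 = Z at *
    rw [mul_zero, sub_zero, sq_eq_zero_iff]
    generalize F.dx X Y Z = U at *
    generalize F.dy X Y Z = V at *
    generalize F.dz X Y Z = W at *
    constructor
    · intro h
      by_contra hW
      -- When the z-derivative W is nonzero, the tangent plane projects onto the whole (x, y)-plane;
      -- lifts of the two basis vectors give X = Y = 0, the centre.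
      have hx0 := h (b 1 - (V / W) • b 2) (by simp; field_simp; ring)
      have hx1 := h (b 0 - (U / W) • b 2) (by simp; field_simp; ring)
      simp at hx0 hx1
      exact hx ⟨hx0, hx1⟩
    · intro hW v hv
      have hUV : U ≠ 0 ∨ V ≠ 0 := by
        by_contra! h
        have := hsm h.1 h.2 hW
        exact hx ⟨this.1, this.2.1⟩
      -- With W = 0, both (X, Y) and the (x, y)-part of v are annihilated by the nonzero covector
      -- (U, V), so they are proportional.
      simp only [hW, mul_zero, add_zero] at hv heu
      rcases hUV with h | h <;> apply mul_left_cancel₀ h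
      · linear_combination b.repr v 1 * heu - Y * hv
      · linear_combination X * hv - b.repr v 0 * heu

open Classical in
/-- The fibres of the projection. -/
theorem ncard_fibre (hφ : IsProjectionFrom f p ℓ φ) (hf : f.IsHomogeneous 3)
    (hb : IsAdapted p.1 ℓ b) (hE : IsExpansion f b F) (hF : F.Smooth) (y : CP1) :
    (φ ⁻¹' {y}).ncard = if y ∈ F.disc.zeros then 1 else 2 := by
  induction y using Projectivization.ind with
  | h w hw =>
  -- J parametrises the line through p in the direction w, with p at s = (1, 0); the factor s₁ of f
  -- ∘ J accounts for p.
  let J : (Fin 2 → ℂ) →ₗ[ℂ] (Fin 3 → ℂ) :=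
    (LinearMap.proj 0).smulRight (b 2) + (LinearMap.proj 1).smulRight (w 0 • b 0 + w 1 • b 1)
  have hJ0 : ∀ s, b.repr (J s) 0 = s 1 * w 0 := fun s => by simp [J]
  have hJ1 : ∀ s, b.repr (J s) 1 = s 1 * w 1 := fun s => by simp [J]
  have hJ2 : ∀ s, b.repr (J s) 2 = s 0 := fun s => by simp [J]
  have hw' := ne_zero_of_fin_two.1 hw
  have hJ : Function.Injective J := by
    rw [← LinearMap.ker_eq_bot, LinearMap.ker_eq_bot']
    intro s hs
    have k0 := hJ0 s
    have k1 := hJ1 s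
    have k2 := hJ2 s
    simp only [hs, map_zero, Finsupp.zero_apply] at k0 k1 k2
    ext i; fin_cases i
    · exact k2.symm
    · rcases hw' with h | h
      · simpa [h] using k0.symm
      · simpa [h] using k1.symm
  have hnz : ¬(F.lin (w 0) (w 1) = 0 ∧ F.quad (w 0) (w 1) = 0 ∧ F.cub (w 0) (w 1) = 0) := by
    rintro ⟨h1, h2, h3⟩
    have := hF.eq_zero_of_line h1 h2 h3
    rcases hw' with h | h
    · exact h this.1
    · exact h this.2
  have heval : ∀ s, eval (J s) f = s 1 * (F.lin (w 0) (w 1) * s 0 ^ 2 +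
      F.quad (w 0) (w 1) * s 0 * s 1 + F.cub (w 0) (w 1) * s 1 ^ 2) := fun s => by
    rw [hE, hJ0, hJ1, hJ2]
    simp only [PointedCubic.eval, PointedCubic.lin, PointedCubic.quad, PointedCubic.cub]; ring
  have himage : Subtype.val '' (φ ⁻¹' {Projectivization.mk ℂ w hw}) =
      Projectivization.map J hJ '' {s : CP1 | F.lin (w 0) (w 1) * s.rep 0 ^ 2 +
        F.quad (w 0) (w 1) * s.rep 0 * s.rep 1 + F.cub (w 0) (w 1) * s.rep 1 ^ 2 = 0} := by
    ext z
    constructor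
    · rintro ⟨x, hx, rfl⟩
      obtain ⟨hx1, hx2⟩ := (hφ.apply_eq_mk_iff hf hb hE hF x hw).1 hx
      obtain ⟨s, hs⟩ : ∃ s, J s = x.1.rep := by
        obtain ⟨k, hk0, hk1⟩ : ∃ k, k * w 0 = b.repr x.1.rep 0 ∧ k * w 1 = b.repr x.1.rep 1 := by
          rcases hw' with h | h
          · exact ⟨b.repr x.1.rep 0 / w 0, by field_simp, by field_simp; linear_combination hx1⟩
          · exact ⟨b.repr x.1.rep 1 / w 1, by field_simp; linear_combination -hx1, by field_simp⟩
        refine ⟨![b.repr x.1.rep 2, k], b.repr.injective (Finsupp.ext fun i => ?_)⟩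
        fin_cases i
        · simpa [hJ0] using hk0
        · simpa [hJ1] using hk1
        · simp [hJ2]
      have hs0 : s ≠ 0 := by
        rintro rfl
        exact x.1.rep_nonzero (by rw [← hs, map_zero])
      refine ⟨Projectivization.mk ℂ s hs0, ?_, ?_⟩
      · obtain ⟨a, ha⟩ := Projectivization.exists_smul_eq_mk_rep ℂ s hs0
        have hes := heval s
        rw [hs] at hes
        have hx0 : eval x.1.rep f = 0 := x.2
        have hq : F.lin (w 0) (w 1) * s 0 ^ 2 +
            F.quad (w 0) (w 1) * s 0 * s 1 + F.cub (w 0) (w 1) * s 1 ^ 2 = 0 := by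
          -- At p the factor s₁ gives no information; p belongs to the fibre only if w is the
          -- tangent direction, and then the residual quadratic vanishes there too.
          by_cases h1 : s 1 = 0
          · rw [h1, hx2 (by simp [← hs, hJ0, h1]) (by simp [← hs, hJ1, h1])]
            ring
          · rw [hx0] at hes
            exact (mul_eq_zero.1 hes.symm).resolve_left h1
        rw [Set.mem_ofPred_eq, ← ha, Units.smul_def]
        simp only [Pi.smul_apply, smul_eq_mul]
        linear_combination a.1 ^ 2 * hq
      · rw [Projectivization.map_mk]
        simp only [hs, Projectivization.mk_rep]
    · rintro ⟨s, hs, rfl⟩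
      rw [Set.mem_ofPred_eq] at hs
      have hJs : J s.rep ≠ 0 := fun h => s.rep_nonzero (hJ (by rw [h, map_zero]))
      have hmap : Projectivization.map J hJ s = Projectivization.mk ℂ (J s.rep) hJs := by
        conv_lhs => rw [← s.mk_rep]
        rw [Projectivization.map_mk]
      have hmem : Projectivization.mk ℂ (J s.rep) hJs ∈ planeCurve f := by
        rw [mk_mem_planeCurve hf, heval, hs, mul_zero]
      rw [hmap]
      refine ⟨⟨_, hmem⟩, ?_, rfl⟩
      rw [Set.mem_preimage, Set.mem_singleton_iff, hφ.apply_eq_mk_iff hf hb hE hF]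
      obtain ⟨a, ha⟩ := Projectivization.exists_smul_eq_mk_rep ℂ _ hJs
      simp only [← ha, Units.smul_def, map_smul, Finsupp.smul_apply, smul_eq_mul, hJ0, hJ1]
      refine ⟨by ring, fun h0 h1 => ?_⟩
      have hs1 : s.rep 1 = 0 := by
        rcases hw' with h | h
        · simpa [h] using h0
        · simpa [h] using h1
      have hs0 : s.rep 0 ≠ 0 := by
        have := ne_zero_of_fin_two.1 s.rep_nonzero
        simpa [hs1] using this
      simpa [hs1, hs0] using hs
  rw [← Set.ncard_image_of_injective _ Subtype.val_injective, himage,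
    Set.ncard_image_of_injective _ (Projectivization.map_injective J hJ),
    ncard_zeros_binaryQuadratic hnz]
  have : F.quad (w 0) (w 1) ^ 2 - 4 * F.lin (w 0) (w 1) * F.cub (w 0) (w 1) = 0 ↔
      Projectivization.mk ℂ w hw ∈ F.disc.zeros := by
    rw [BinaryQuartic.mk_mem_zeros, F.disc_eval]
  simp only [this]

/-- Every zero of the discriminant has a preimage by the fibre count, and any preimage is ramified.
-/
theorem branchPoints_eq (hφ : IsProjectionFrom f p ℓ φ) (hf : f.IsHomogeneous 3)
    (hb : IsAdapted p.1 ℓ b) (hE : IsExpansion f b F) (hF : F.Smooth) :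
    branchPoints f φ = F.disc.zeros := by
  ext y
  constructor
  · rintro ⟨x, hx, rfl⟩
    exact (hφ.isRamifiedAt_iff hf hb hE hF x).1 hx
  · intro hy
    have := hφ.ncard_fibre hf hb hE hF y
    rw [if_pos hy, Set.ncard_eq_one] at this
    obtain ⟨x, hx⟩ := this
    have hxy : φ x = y := by
      have : x ∈ φ ⁻¹' {y} := by rw [hx]; rfl
      exact this
    exact ⟨x, (hφ.isRamifiedAt_iff hf hb hE hF x).2 (by rwa [hxy]), hxy⟩

theorem ncard_ramificationPoints (hφ : IsProjectionFrom f p ℓ φ) (hf : f.IsHomogeneous 3)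
    (hb : IsAdapted p.1 ℓ b) (hE : IsExpansion f b F) (hF : F.Smooth) :
    (ramificationPoints f φ).ncard = (branchPoints f φ).ncard := by
  symm
  apply Set.InjOn.ncard_image
  -- The fibre through a ramified point is a singleton, so φ is injective on ramification points.
  intro x hx x' hx' h
  have hy := (hφ.isRamifiedAt_iff hf hb hE hF x).1 hx
  have := hφ.ncard_fibre hf hb hE hF (φ x)
  rw [if_pos hy, Set.ncard_eq_one] at this
  obtain ⟨z, hz⟩ := this
  have h1 : x ∈ φ ⁻¹' {φ x} := rfl
  have h2 : x' ∈ φ ⁻¹' {φ x} := h.symm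
  rw [hz] at h1 h2
  exact h1.trans h2.symm

end IsProjectionFrom

/-! ### Independence of the coordinates and of the point -/

/-- The discriminants with respect to two bases with the same last vector are equivalent. -/
theorem IsExpansion.zerosEquiv_disc {b' : Module.Basis (Fin 3) ℂ (Fin 3 → ℂ)} {F' : PointedCubic}
    (hE : IsExpansion f b F) (hE' : IsExpansion f b' F') (h : b' 2 = b 2) :
    BinaryQuartic.ZerosEquiv F'.disc F.disc := by
  let M : Fin 3 → Fin 3 → ℂ := fun i j => b.repr (b' j) i
  have h20 : b.repr (b' 2) 0 = 0 := by simp [h]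
  have h21 : b.repr (b' 2) 1 = 0 := by simp [h]
  have h22 : b.repr (b' 2) 2 = 1 := by simp [h]
  refine BinaryQuartic.zerosEquiv_of_eval_eq (p := M 0 0) (q := M 0 1) (r := M 1 0) (s := M 1 1)
    ?_ fun x y => ?_
  · intro hdet
    have hker : ∀ c d : ℂ, c * M 0 0 + d * M 0 1 = 0 → c * M 1 0 + d * M 1 1 = 0 →
        c = 0 ∧ d = 0 := fun c d h0 h1 => by
      have hz : c • b' 0 + d • b' 1 - (c * M 2 0 + d * M 2 1) • b' 2 = 0 := by
        apply b.repr.injective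
        ext i
        fin_cases i
        · simpa [h20, M] using h0
        · simpa [h21, M] using h1
        · simp [h22, M]
      have k0 := congr_arg (fun v => b'.repr v 0) hz
      have k1 := congr_arg (fun v => b'.repr v 1) hz
      simp at k0 k1
      exact ⟨k0, k1⟩
    -- If the determinant vanishes, the columns of the adjugate lie in the kernel, so every entry of
    -- M is zero, which `hker` also excludes.
    obtain ⟨a1, a2⟩ := hker (M 1 1) (-M 1 0) (by linear_combination hdet) (by ring)
    obtain ⟨a3, a4⟩ := hker (M 0 1) (-M 0 0) (by ring) (by linear_combination -hdet)
    have := hker 1 0 (by simpa using a4) (by simpa using a2)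
    simp at this
  · have key : ∀ t, F'.eval x y t = F.eval (M 0 0 * x + M 0 1 * y) (M 1 0 * x + M 1 1 * y)
        (M 2 0 * x + M 2 1 * y + t) := fun t => by
      have h1 := hE (x • b' 0 + y • b' 1 + t • b' 2)
      have h2 := hE' (x • b' 0 + y • b' 1 + t • b' 2)
      rw [h1] at h2
      simp only [map_add, map_smul, Finsupp.add_apply, Finsupp.smul_apply, smul_eq_mul, h20, h21,
        h22, b'.repr_self, Finsupp.single_apply] at h2
      simp at h2
      rw [← h2]
      congr 1 <;> simp only [M] <;> ring
    rw [F.disc_eval, F'.disc_eval]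
    -- Three values of t recover the coefficients of a quadratic. They change by the translation z ↦
    -- z + n, which preserves its discriminant.
    have k0 := key 0
    have k1 := key 1
    have k2 := key (-1)
    simp only [PointedCubic.eval] at k0 k1 k2
    generalize F.lin _ _ = l at *
    generalize F.quad _ _ = q at *
    generalize F.cub _ _ = c at *
    generalize M 2 0 * x + M 2 1 * y = n at *
    have hl : F'.lin x y = l := by linear_combination (k1 + k2) / 2 - k0
    have hq : F'.quad x y = q + 2 * n * l := by linear_combination (k1 - k2) / 2
    have hc : F'.cub x y = c + n * q + n ^ 2 * l := by linear_combination k0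
    rw [hl, hq, hc]; ring

theorem exists_basis_of_ne {p q : CP2} (h : p ≠ q) :
    ∃ b : Module.Basis (Fin 3) ℂ (Fin 3 → ℂ), b 0 = q.rep ∧ b 2 = p.rep := by
  have hli := (Projectivization.linearIndependent_pair_iff_ne (K := ℂ)).2 h.symm
  obtain ⟨e, he⟩ := exists_linearIndependent_snoc_of_lt_finrank (n := 2) hli (by simp)
  let c := basisOfLinearIndependentOfCardEqFinrank he (by simp)
  have hc : ⇑c = Fin.snoc ![q.rep, p.rep] e :=
    coe_basisOfLinearIndependentOfCardEqFinrank he (by simp)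
  refine ⟨c.reindex (Equiv.swap 1 2), ?_, ?_⟩
  · simp [hc, Equiv.swap_apply_of_ne_of_ne]
  · simp [hc]

/-- A cubic through `(0 : 0 : 1)` and `(1 : 0 : 0)` with these two points exchanged. -/
def PointedCubic.swap (F : PointedCubic) : PointedCubic where
  l0 := F.q0
  l1 := F.c1
  q0 := F.l0
  q1 := F.q1
  q2 := F.c2
  c0 := 0
  c1 := F.l1
  c2 := F.q2
  c3 := F.c3

/-- The discriminants of a smooth cubic at two points are equivalent. -/
theorem zerosEquiv_disc_of_points {q : planeCurve f} {b' : Module.Basis (Fin 3) ℂ (Fin 3 → ℂ)}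
    {F' : PointedCubic} (hf : f.IsHomogeneous 3) (hs : IsSmoothPlaneCurve f)
    (hE : IsExpansion f b F) (hb : b 2 = p.1.rep) (hE' : IsExpansion f b' F')
    (hb' : b' 2 = q.1.rep) : BinaryQuartic.ZerosEquiv F.disc F'.disc := by
  by_cases hpq : p.1 = q.1
  · exact hE'.zerosEquiv_disc hE (by rw [hb, hb', hpq])
  obtain ⟨c, hc0, hc2⟩ := exists_basis_of_ne hpq
  obtain ⟨G, hG⟩ := exists_isExpansion hf c (by rw [hc2]; exact p.2)
  -- The x³ coefficient vanishes because q lies on the curve; `swap` relies on this, since it drops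
  -- that coefficient.
  have hc : G.c0 = 0 := by
    have h : eval (c 0) f = 0 := by rw [hc0]; exact q.2
    rw [hG] at h
    simpa [PointedCubic.eval, PointedCubic.cub] using h
  have hG' : IsExpansion f (c.reindex (Equiv.swap 0 2)) G.swap := fun v => by
    rw [hG]
    simp only [Module.Basis.repr_reindex_apply, Equiv.symm_swap, Equiv.swap_apply_left,
      Equiv.swap_apply_right, Equiv.swap_apply_of_ne_of_ne (show (1 : Fin 3) ≠ 0 by decide)
      (show (1 : Fin 3) ≠ 2 by decide), PointedCubic.eval, PointedCubic.lin, PointedCubic.quad,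
      PointedCubic.cub, PointedCubic.swap, hc]
    ring
  have h1 := hG.zerosEquiv_disc hE (by rw [hb, hc2])
  have h2 := hG'.zerosEquiv_disc hE' (by simp [hb', hc0])
  refine h1.trans (BinaryQuartic.ZerosEquiv.trans ?_ h2.symm)
  refine BinaryQuartic.zerosEquiv_of_invariants (hG.smooth hf hs).disc_nonsingular
    (hG'.smooth hf hs).disc_nonsingular ?_ ?_
  · simp only [BinaryQuartic.invI, PointedCubic.disc, PointedCubic.swap, hc]; ring
  · simp only [BinaryQuartic.invJ, PointedCubic.disc, PointedCubic.swap, hc]; ring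

theorem mainTheorem7 (f : MvPolynomial (Fin 3) ℂ) (hf : f.IsHomogeneous 3)
    (hsmooth : IsSmoothPlaneCurve f) :
    -- the projection from a point of the curve is a well-defined morphism
    (∀ (p : planeCurve f) (ℓ : (Fin 3 → ℂ) →ₗ[ℂ] (Fin 2 → ℂ)),
      LinearMap.ker ℓ = p.1.submodule → ∃! φ, IsProjectionFrom f p ℓ φ) ∧
    -- it is 2:1 with four ramification points and four branch points
    (∀ (p : planeCurve f) (ℓ : (Fin 3 → ℂ) →ₗ[ℂ] (Fin 2 → ℂ)) (φ : planeCurve f → CP1),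
      IsProjectionFrom f p ℓ φ →
        (∀ y ∉ branchPoints f φ, (φ ⁻¹' {y}).ncard = 2) ∧
        (∀ y ∈ branchPoints f φ, (φ ⁻¹' {y}).ncard = 1) ∧
        (ramificationPoints f φ).ncard = 4 ∧
        (branchPoints f φ).ncard = 4) ∧
    -- the class of the set of branch points under `SL(2)` does not depend on the point
    (∀ (p q : planeCurve f) (ℓ m : (Fin 3 → ℂ) →ₗ[ℂ] (Fin 2 → ℂ)) (φ ψ : planeCurve f → CP1),
      IsProjectionFrom f p ℓ φ → IsProjectionFrom f q m ψ →
        ∃ g : Matrix.SpecialLinearGroup (Fin 2) ℂ,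
          (fun y : CP1 => g • y) '' branchPoints f φ = branchPoints f ψ) := by
  refine ⟨fun p ℓ hℓ => existsUnique_isProjectionFrom hf hsmooth hℓ, fun p ℓ φ hφ => ?_,
    fun p q ℓ m φ ψ hφ hψ => ?_⟩
  · obtain ⟨b, hb⟩ := exists_isAdapted hφ.ker_eq
    obtain ⟨F, hE⟩ := exists_isExpansion hf b (by rw [hb.apply_two]; exact p.2)
    have hF := hE.smooth hf hsmooth
    have hB := hφ.branchPoints_eq hf hb hE hF
    have h4 : (branchPoints f φ).ncard = 4 := by rw [hB, hF.disc_nonsingular.ncard_zeros]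
    refine ⟨fun y hy => ?_, fun y hy => ?_, ?_, h4⟩
    · rw [hφ.ncard_fibre hf hb hE hF, if_neg (by rwa [← hB])]
    · rw [hφ.ncard_fibre hf hb hE hF, if_pos (by rwa [← hB])]
    · rw [hφ.ncard_ramificationPoints hf hb hE hF, h4]
  · obtain ⟨b, hb⟩ := exists_isAdapted hφ.ker_eq
    obtain ⟨c, hc⟩ := exists_isAdapted hψ.ker_eq
    obtain ⟨F, hE⟩ := exists_isExpansion hf b (by rw [hb.apply_two]; exact p.2)
    obtain ⟨G, hG⟩ := exists_isExpansion hf c (by rw [hc.apply_two]; exact q.2)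
    rw [hφ.branchPoints_eq hf hb hE (hE.smooth hf hsmooth),
      hψ.branchPoints_eq hf hc hG (hG.smooth hf hsmooth)]
    exact zerosEquiv_disc_of_points hf hsmooth hE hb.apply_two hG hc.apply_two
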